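/- **Setting.** Let $(\mathsf X,\mathcal X)$ be a measurable space, $n\ge 0$ an integer, $M_0$ a probability measure on $\mathsf X$, $M_1,\dots,M_n$ Markov kernels on $\mathsf X$, and $G_0,\dots,G_n:\mathsf X\to(0,\infty)$ measurable functions that are bounded above. Let $c_0,\dots,c_n>0$ be real numbers and, for $N\ge1$, put $N_p=\lceil c_pN\rceil$. Only integers $N\ge 1$ with $\min_{0\le p\le n}N_p\ge 2$ are considered (call them admissible; all large $N$ are admissible). Write $[m]=\{1,\dots,m\}$, and for $a_1,\dots,a_m>0$ let $\mathcal C(a_1,\dots,a_m)$ be the distribution on $[m]$ with probabilities $a_j/\sum_i a_i$. **Measures $\mu_b$.** For $b=(b_0,\dots,b_n)\in\{0,1\}^{n+1}$ let $(X_p,X_p')_{0\le p\le n}$ be the Markov chain on $\mathsf X^2$ with: if $b_0=0$, $X_0,X_0'\sim M_0$ independently, and if $b_0=1$, $X_0'=X_0\sim M_0$; for $p=1,\dots,n$, if $b_p=0$, $X_p\sim M_p(X_{p-1},\cdot)$ and $X_p'\sim M_p(X_{p-1}',\cdot)$ independently, and if $b_p=1$, $X_p'=X_p\sim M_p(X_{p-1},\cdot)$.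 With $E_b$ the expectation for this chain, for bounded measurable $\varphi:\mathsf X^2\to\mathbb R$ put $$\mu_b(\varphi)=E_b\Big[\varphi(X_n,X_n')\prod_{p=0}^{n-1}G_p(X_p)G_p(X_p')\Big].$$ **Particle system.** $\zeta_0^i\sim M_0$ independently for $i\in[N_0]$; for $p=1,\dots,n$, given the past and independently over $i\in[N_p]$, $A_{p-1}^i\sim\mathcal C(G_{p-1}(\zeta_{p-1}^1),\dots,G_{p-1}(\zeta_{p-1}^{N_{p-1}}))$ and then $\zeta_p^i\sim M_p(\zeta_{p-1}^{A_{p-1}^i},\cdot)$. Let $A=(A_p^i)$, $\zeta=(\zeta_p^i)$ and $$\gamma_n^N(1)=\prod_{p=0}^{n-1}\frac1{N_p}\sum_{i\in[N_p]}G_p(\zeta_p^i).$$ **Tracing variables.** Given $(A,\zeta)$, let $K_n^1$ be uniform on $[N_n]$ and $K_p^1=A_p^{K_{p+1}^1}$ for $p=n-1,\dots,0$. Given $(A,\zeta)$ and $K^1$, let $K_n^2$ be uniform on $[N_n]$ and, for $p=n-1,\dots,0$, let $K_p^2=A_p^{K_{p+1}^2}$ if $K_{p+1}^2\ne K_{p+1}^1$,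 and $K_p^2\sim\mathcal C(G_p(\zeta_p^1),\dots,G_p(\zeta_p^{N_p}))$ if $K_{p+1}^2=K_{p+1}^1$. Let $\mathcal I(b)$ be the set of pairs $(k^1,k^2)\in([N_0]\times\cdots\times[N_n])^2$ such that, for each $p$, $k_p^1=k_p^2$ if and only if $b_p=1$. Define $$\mu_b^N(\varphi)=\Big[\prod_{p=0}^{n}N_p^{\,b_p}\Big(\frac{N_p}{N_p-1}\Big)^{1-b_p}\Big]\gamma_n^N(1)^2\,E\Big[\mathbb I\{(K^1,K^2)\in\mathcal I(b)\}\,\varphi(\zeta_n^{K_n^1},\zeta_n^{K_n^2})\,\Big|\,A,\zeta\Big].$$ **Theorem 2.** For every $b\in\{0,1\}^{n+1}$ and every bounded measurable $\varphi:\mathsf X^2\to\mathbb R$: 1. $E\{\mu_b^N(\varphi)\}=\mu_b(\varphi)$ for all admissible $N$; 2. $\sup_{N}N\,E\big[\{\mu_b^N(\varphi)-\mu_b(\varphi)\}^2\big]<\infty$, the supremum being over all admissible $N$, and hence $\mu_b^N(\varphi)\to\mu_b(\varphi)$ in probability as $N\to\infty$. -/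

import Mathlib

open MeasureTheory ProbabilityTheory Filter Topology

namespace ParticleFilter

noncomputable section

/-- A discrete-time Feynman--Kac model: an initial distribution `M₀`, Markov kernels
`M₁, M₂, …` and strictly positive, bounded above, measurable potentials `G₀, G₁, …`.
`M p` is the transition from time `p` to time `p + 1`, i.e. the kernel `M_{p+1}`.
With a time horizon `n`, only `M 0, …, M (n - 1)` and `G 0, …, G (n - 1)` are used below. -/
structure Model (X : Type*) [MeasurableSpace X] where
  M₀ : Measure X
  M : ℕ → Kernel X X
  G : ℕ → X → ℝ
  isProbabilityMeasure_M₀ : IsProbabilityMeasure M₀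
  isMarkovKernel_M : ∀ p, IsMarkovKernel (M p)
  measurable_G : ∀ p, Measurable (G p)
  G_pos : ∀ p x, 0 < G p x
  G_bdd : ∀ p, ∃ C, ∀ x, G p x ≤ C

attribute [instance] Model.isProbabilityMeasure_M₀ Model.isMarkovKernel_M

variable {X : Type*} [MeasurableSpace X]

/-! ### The measures `μ_b` -/

/-- One step of the pair chain `(X_p, X'_p) ↦ (X_{p+1}, X'_{p+1})`. If the bit is `0`, both
components move independently; if it is `1`, `X'_{p+1} = X_{p+1} ∼ M_{p+1}(X_p, ·)`. -/
def pairKernel (F : Model X) (p : ℕ) (bit : Bool) : Kernel (X × X) (X × X) :=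
  if bit then
    ((F.M p).comap Prod.fst measurable_fst).map (fun x => (x, x))
  else
    Kernel.parallelComp (F.M p) (F.M p)

/-- Law of the initial pair `(X_0, X'_0)`. -/
def pairInit (F : Model X) (bit : Bool) : Measure (X × X) :=
  if bit then F.M₀.map (fun x => (x, x)) else F.M₀.prod F.M₀

/-- Law of the path `(X_p, X'_p)_{0 ≤ p ≤ n}` of the pair chain attached to the binary string
`b = (b_0, …, b_n)`. -/
def pairLaw (F : Model X) : (n : ℕ) → (Fin (n + 1) → Bool) → Measure (Fin (n + 1) → X × X)
  | 0, b => (pairInit F (b 0)).map (fun x _ => x)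
  | n + 1, b =>
      (pairLaw F n (Fin.init b) ⊗ₘ
        (pairKernel F n (b (Fin.last (n + 1)))).comap
          (fun x : Fin (n + 1) → X × X => x (Fin.last n)) (measurable_pi_apply _)).map
        (fun y => (Fin.snoc y.1 y.2 : Fin (n + 2) → X × X))

/-- `μ_b(φ) = E_b[φ(X_n, X'_n) ∏_{p<n} G_p(X_p) G_p(X'_p)]`. -/
def mu (F : Model X) (n : ℕ) (b : Fin (n + 1) → Bool) (φ : X × X → ℝ) : ℝ :=
  ∫ x, φ (x (Fin.last n)) *
    ∏ p : Fin n, F.G p (x p.castSucc).1 * F.G p (x p.castSucc).2 ∂(pairLaw F n b)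

/-! ### The particle system -/

/-- The probability that the categorical distribution
`𝒞(G_p(z^1), …, G_p(z^k))` gives to `j`. -/
def catProb (F : Model X) (p : ℕ) {k : ℕ} (z : Fin k → X) (j : Fin k) : ℝ :=
  F.G p (z j) / ∑ i, F.G p (z i)

lemma measurable_catProb (F : Model X) (p : ℕ) {k : ℕ} (j : Fin k) :
    Measurable (fun z : Fin k → X => catProb F p z j) := by
  have h : ∀ i : Fin k, Measurable (fun z : Fin k → X => F.G p (z i)) :=
    fun i => (F.measurable_G p).comp (measurable_pi_apply i)
  exact (h j).div (Finset.measurable_sum _ fun i _ => h i)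

lemma catProb_le_one (F : Model X) (p : ℕ) {k : ℕ} (z : Fin k → X) (j : Fin k) :
    catProb F p z j ≤ 1 := by
  refine div_le_one_of_le₀ ?_ (Finset.sum_nonneg fun i _ => (F.G_pos p _).le)
  exact Finset.single_le_sum (f := fun i => F.G p (z i))
    (fun i _ => (F.G_pos p _).le) (Finset.mem_univ j)

/-- The categorical distribution `𝒞(G_p(z^1), …, G_p(z^k))`, as a kernel in `z`. -/
def catKernel (F : Model X) (p k : ℕ) : Kernel (Fin k → X) (Fin k) where
  toFun z := ∑ j, ENNReal.ofReal (catProb F p z j) • Measure.dirac j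
  measurable' := by
    refine Measure.measurable_of_measurable_coe _ fun s _ => ?_
    simp only [Measure.coe_finsetSum, Finset.sum_apply, Measure.smul_apply, smul_eq_mul]
    exact Finset.measurable_sum _ fun j _ =>
      (measurable_catProb F p j).ennreal_ofReal.mul_const _

instance (F : Model X) (p k : ℕ) : IsFiniteKernel (catKernel F p k) := by
  refine ⟨⟨k, by simp, fun z => ?_⟩⟩
  change (∑ j, ENNReal.ofReal (catProb F p z j) • Measure.dirac j : Measure (Fin k)) _ ≤ _
  simp only [Measure.coe_finsetSum, Finset.sum_apply, Measure.smul_apply, smul_eq_mul,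
    measure_univ, mul_one]
  refine (Finset.sum_le_card_nsmul _ _ 1 fun j _ => ?_).trans (by simp)
  exact ENNReal.ofReal_le_one.2 (catProb_le_one F p z j)

/-- Law of one pair `(A_p^i, ζ_{p+1}^i)` given `ζ_p = z`:
`A_p^i ∼ 𝒞(G_p(z^1), …, G_p(z^k))` and then `ζ_{p+1}^i ∼ M_{p+1}(z^{A_p^i}, ·)`. -/
def offspringKernel (F : Model X) (p k : ℕ) : Kernel (Fin k → X) (Fin k × X) :=
  Kernel.compProd (catKernel F p k)
    ((F.M p).comap (fun y : (Fin k → X) × Fin k => y.1 y.2)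
      (measurable_from_prod_countable_left fun j => measurable_pi_apply j))

instance (F : Model X) (p k : ℕ) : IsFiniteKernel (offspringKernel F p k) := by
  unfold offspringKernel; infer_instance

/-- `l` independent draws from a kernel. -/
def iidKernel {α β : Type*} [MeasurableSpace α] [MeasurableSpace β] (κ : Kernel α β)
    [IsFiniteKernel κ] (l : ℕ) : Kernel α (Fin l → β) where
  toFun a := Measure.pi fun _ => κ a
  measurable' := by
    refine Measurable.measure_of_isPiSystem generateFrom_pi.symm isPiSystem_pi ?_ ?_
    · rintro _ ⟨s, hs, rfl⟩
      simp only [Measure.pi_pi]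
      exact Finset.measurable_prod _ fun i _ => κ.measurable_coe (hs i (Set.mem_univ i))
    · simp only [Measure.pi_univ]
      exact Finset.measurable_prod _ fun i _ => κ.measurable_coe MeasurableSet.univ

/-- Values of the particles `ζ = ζ_{0:n}`, `ζ_p = (ζ_p^i)_{i ∈ [N_p]}`. -/
abbrev Particles (X : Type*) (N : ℕ → ℕ) (n : ℕ) : Type _ :=
  (p : Fin (n + 1)) → Fin (N p) → X

/-- Values of the ancestor indices `A = A_{0:n-1}`, `A_p = (A_p^i)_{i ∈ [N_{p+1}]}`,
`A_p^i ∈ [N_p]`. -/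
abbrev Ancestors (N : ℕ → ℕ) (n : ℕ) : Type :=
  (p : Fin n) → Fin (N (p + 1)) → Fin (N p)

/-- Values of the particle system `(A, ζ)`. -/
abbrev System (X : Type*) (N : ℕ → ℕ) (n : ℕ) : Type _ :=
  Ancestors N n × Particles X N n

/-- Append the ancestor indices `A_n` and the particles `ζ_{n+1}` to the particle system up to
time `n`. -/
def System.extend {N : ℕ → ℕ} {n : ℕ} (s : System X N n)
    (y : Fin (N (n + 1)) → Fin (N n) × X) : System X N (n + 1) :=
  (Fin.snoc (α := fun p : Fin (n + 1) => Fin (N (p + 1)) → Fin (N p)) s.1 (fun i => (y i).1),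
   Fin.snoc (α := fun p : Fin (n + 2) => Fin (N p) → X) s.2 (fun i => (y i).2))

/-- Law of the particle system `(A, ζ)` produced by the particle filter with `N p` particles at
time `p`. -/
def particleLaw (F : Model X) (N : ℕ → ℕ) : (n : ℕ) → Measure (System X N n)
  | 0 => (Measure.pi fun _ : Fin (N 0) => F.M₀).map
      (fun z => (finZeroElim, Fin.cons z finZeroElim))
  | n + 1 =>
      (particleLaw F N n ⊗ₘ
        (iidKernel (offspringKernel F n (N n)) (N (n + 1))).comap
          (fun s : System X N n => s.2 (Fin.last n))
          ((measurable_pi_apply _).comp measurable_snd)).map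
        (fun y => System.extend y.1 y.2)

/-- `η_p^N(f) = N_p⁻¹ ∑_i f(ζ_p^i)`. -/
def etaN {N : ℕ → ℕ} {n : ℕ} (s : System X N n) (p : Fin (n + 1)) (f : X → ℝ) : ℝ :=
  (N p : ℝ)⁻¹ * ∑ i, f (s.2 p i)

/-- `γ_n^N(f) = (∏_{p<n} η_p^N(G_p)) η_n^N(f)`. -/
def gammaN (F : Model X) {N : ℕ → ℕ} {n : ℕ} (s : System X N n) (f : X → ℝ) : ℝ :=
  (∏ p : Fin n, etaN s p.castSucc (F.G p)) * etaN s (Fin.last n) f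

/-! ### The tracing variables and `μ_b^N` -/

/-- The set `[N_{0:n}] = [N_0] × ⋯ × [N_n]`. -/
abbrev Lineage (N : ℕ → ℕ) (n : ℕ) : Type := (p : Fin (n + 1)) → Fin (N p)

/-- Conditional probability of `K^1 = k` given `(A, ζ) = s`: `K_n^1` is uniform on `[N_n]`, and
`K_p^1 = A_p^{K_{p+1}^1}`. -/
def traceProb₁ {N : ℕ → ℕ} {n : ℕ} (s : System X N n) (k : Lineage N n) : ℝ :=
  (N n : ℝ)⁻¹ * ∏ p : Fin n, if k p.castSucc = s.1 p (k p.succ) then 1 else 0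

/-- Conditional probability of `K^2 = k'` given `(A, ζ) = s` and `K^1 = k`: `K_n^2` is uniform
on `[N_n]`; `K_p^2 = A_p^{K_{p+1}^2}` if `K_{p+1}^2 ≠ K_{p+1}^1`, and
`K_p^2 ∼ 𝒞(G_p(ζ_p^1), …, G_p(ζ_p^{N_p}))` if `K_{p+1}^2 = K_{p+1}^1`. -/
def traceProb₂ (F : Model X) {N : ℕ → ℕ} {n : ℕ} (s : System X N n) (k k' : Lineage N n) : ℝ :=
  (N n : ℝ)⁻¹ * ∏ p : Fin n,
    if k' p.succ = k p.succ then catProb F p (s.2 p.castSucc) (k' p.castSucc)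
    else if k' p.castSucc = s.1 p (k' p.succ) then 1 else 0

lemma measurable_ancestor_eq {N : ℕ → ℕ} {n : ℕ} (p : Fin n) (j : Fin (N p))
    (i : Fin (N (p + 1))) :
    Measurable (fun s : System X N n => if j = s.1 p i then (1 : ℝ) else 0) := by
  have h : Measurable (fun s : System X N n => s.1 p i) :=
    (measurable_pi_apply i).comp ((measurable_pi_apply p).comp measurable_fst)
  exact (measurable_of_countable (fun l : Fin (N p) => if j = l then (1 : ℝ) else 0)).comp h

lemma measurable_traceProb₁ {N : ℕ → ℕ} {n : ℕ} (k : Lineage N n) :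
    Measurable (fun s : System X N n => traceProb₁ s k) :=
  (Finset.measurable_prod _ fun p _ =>
    measurable_ancestor_eq p (k p.castSucc) (k p.succ)).const_mul _

lemma measurable_traceProb₂ (F : Model X) {N : ℕ → ℕ} {n : ℕ} (k k' : Lineage N n) :
    Measurable (fun s : System X N n => traceProb₂ F s k k') := by
  refine (Finset.measurable_prod _ fun p _ => ?_).const_mul _
  by_cases h : k' p.succ = k p.succ
  · simp only [h, if_true]
    exact (measurable_catProb F p _).comp ((measurable_pi_apply _).comp measurable_snd)
  · simp only [h, if_false]
    exact measurable_ancestor_eq p (k' p.castSucc) (k' p.succ)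

/-- Conditional law of the tracing variables `(K^1, K^2)` given `(A, ζ)`. -/
def traceKernel (F : Model X) (N : ℕ → ℕ) (n : ℕ) :
    Kernel (System X N n) (Lineage N n × Lineage N n) where
  toFun s := ∑ k : Lineage N n × Lineage N n,
    ENNReal.ofReal (traceProb₁ s k.1 * traceProb₂ F s k.1 k.2) • Measure.dirac k
  measurable' := by
    refine Measure.measurable_of_measurable_coe _ fun t _ => ?_
    simp only [Measure.coe_finsetSum, Finset.sum_apply, Measure.smul_apply, smul_eq_mul]
    exact Finset.measurable_sum _ fun k _ =>
      ((measurable_traceProb₁ k.1).mul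
        (measurable_traceProb₂ F k.1 k.2)).ennreal_ofReal.mul_const _

/-- The sample space carrying `((A, ζ), (K^1, K^2))`. -/
abbrev Sample (X : Type*) (N : ℕ → ℕ) (n : ℕ) : Type _ :=
  System X N n × (Lineage N n × Lineage N n)

/-- Joint law of `((A, ζ), (K^1, K^2))`. -/
def jointLaw (F : Model X) (N : ℕ → ℕ) (n : ℕ) : Measure (Sample X N n) :=
  particleLaw F N n ⊗ₘ traceKernel F N n

/-- The set `𝓘(b)` of pairs of strings that coincide in coordinate `p` exactly when
`b_p = 1`. -/
def coincidence {N : ℕ → ℕ} {n : ℕ} (b : Fin (n + 1) → Bool) : Set (Lineage N n × Lineage N n) :=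
  {k | ∀ p, k.1 p = k.2 p ↔ b p = true}

/-- The particle approximation `μ_b^N(φ)`, a random variable on the sample space of
`((A, ζ), (K^1, K^2))`, defined by the conditional expectation given `(A, ζ)`. -/
def muN (F : Model X) (N : ℕ → ℕ) (n : ℕ) (b : Fin (n + 1) → Bool) (φ : X × X → ℝ) :
    Sample X N n → ℝ := fun ω =>
  (∏ p : Fin (n + 1), if b p then (N p : ℝ) else (N p : ℝ) / ((N p : ℝ) - 1)) *
    gammaN F ω.1 (fun _ => 1) ^ 2 *
    ((jointLaw F N n)[fun ω' : Sample X N n =>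
        (coincidence b).indicator
          (fun k => φ (ω'.1.2 (Fin.last n) (k.1 (Fin.last n)),
            ω'.1.2 (Fin.last n) (k.2 (Fin.last n)))) ω'.2
      | MeasurableSpace.comap Prod.fst inferInstance]) ω

/-- The particle numbers `N_p = ⌈c_p N⌉`. -/
def particleNumber (c : ℕ → ℝ) (N : ℕ) (p : ℕ) : ℕ := ⌈c p * N⌉₊

end

end ParticleFilter

namespace ParticleFilter

set_option linter.unusedSectionVars false

variable {X : Type*} [MeasurableSpace X]

/-! ### Sums over lineages -/

/-! Conditionally on the particle system, `μ_b^N(φ)` is a bilinear sum `∑ w i j * φ(ζ_n^i, ζ_n^j)`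
whose nonnegative weights (`pairWeight`) come from summing over the two lineages. This removes the
tracing variables: `muN_ae_eq` identifies `muN` almost surely with the function `estimator` of the
particle system. Tracing is Markov backwards in time and the condition defining `coincidence b`
factors over times, so the weights at time `n + 1` are an explicit function (`stepWeight`) of those
at time `n` and of the new ancestors (`pairWeight_extend`).

Lack of bias is then one conditional expectation. Given the past, the new pairs (ancestor, particle)
are i.i.d., and the factors in `stepWeight` cancel both the number of pairs and the normalisers of
the categorical draws. The conditional mean of the estimator of `φ` is the estimator, one time
earlier, of `transfer φ` (`integral_stepSum`). Since `μ_b` obeys the same recursion (`mu_succ`),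
induction on `n` with varying `φ` concludes.

For the mean square error, the conditional variance of one step is controlled by the Efron–Stein
inequality: dropping index `i` from the double sum changes it by at most `‖φ‖_∞` times the `i`-th
row plus column sums of the weights (`variance_stepSum_le`). It remains to see that the sum of
squared margins, `marginSq`, has mean `O(1/N)`. The quantity `N_p * E[marginSq]` grows at each step
by at most a factor free of `N` (`integral_marginSq_stepWeight`), and it is at most 8 at time 0
(`integral_marginSq_initial`). The mean square error at time `n + 1` is therefore at most an
`O(1/N)` term plus the error at time `n` for `transfer φ` (`integral_sub_sq_succ_le`), which gives
the rate by induction. Chebyshev's inequality yields convergence in probability.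

Time 0 needs no separate computation: the initial particles are the offspring of a single fictitious
parent in `initialModel`. -/

lemma sum_lineage_succ {N : ℕ → ℕ} {n : ℕ} (f : Lineage N (n + 1) → ℝ) :
    ∑ k, f k = ∑ k : Lineage N n, ∑ i : Fin (N (n + 1)),
      f (Fin.snoc (α := fun p : Fin (n + 2) => Fin (N p)) k i) := by
  rw [← (Fin.snocEquiv (fun p : Fin (n + 2) => Fin (N p))).sum_comp f, Fintype.sum_prod_type,
    Finset.sum_comm]
  rfl

lemma sum_lineage_zero {N : ℕ → ℕ} (f : Lineage N 0 → ℝ) :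
    ∑ k, f k = ∑ i : Fin (N 0), f (Fin.cons (α := fun p : Fin 1 => Fin (N p)) i finZeroElim) := by
  rw [← (Fin.consEquiv (fun p : Fin 1 => Fin (N p))).sum_comp f, Fintype.sum_prod_type]
  refine Finset.sum_congr rfl fun i _ => ?_
  rw [Fintype.sum_eq_single (finZeroElim : (p : Fin 0) → Fin (N p.succ))]
  · rfl
  · intro x hx
    exact (hx (Subsingleton.elim _ _)).elim

/-- The total mass of a backward Markov chain is the mass of its law at the last time. -/
lemma sum_lineage_chain {N : ℕ → ℕ} {n : ℕ} (t : (p : Fin n) → Fin (N (p + 1)) → Fin (N p) → ℝ)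
    (ht : ∀ p i, ∑ j, t p i j = 1) (u : Fin (N n) → ℝ) :
    ∑ k : Lineage N n, u (k (Fin.last n)) * ∏ p : Fin n, t p (k p.succ) (k p.castSucc) =
      ∑ i, u i := by
  induction n with
  | zero =>
    rw [sum_lineage_zero]
    refine Finset.sum_congr rfl fun i _ => ?_
    simp only [Finset.univ_eq_empty, Finset.prod_empty, mul_one]
    rfl
  | succ n ih =>
    rw [sum_lineage_succ]
    -- The chain starts at the last time, so moving its initial weights `u` one step back through
    -- `t` leaves a chain with one time fewer and the same total mass.
    have := ih (fun p => t p.castSucc) (fun p => ht p.castSucc)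
      (fun j => ∑ i : Fin (N (n + 1)), u i * t (Fin.last n) i j)
    rw [Finset.sum_comm] at this
    simp_rw [← Finset.mul_sum] at this
    have h2 : ∀ i, ∑ j, t (Fin.last n) i j = 1 := fun i => ht (Fin.last n) i
    have h3 : ∑ i, u i * ∑ j, t (Fin.last n) i j = ∑ i, u i :=
      Finset.sum_congr rfl fun i _ => by rw [h2 i, mul_one]
    refine Eq.trans ?_ (this.trans h3)
    refine Finset.sum_congr rfl fun k _ => ?_
    rw [Finset.sum_mul]
    refine Finset.sum_congr rfl fun i _ => ?_
    rw [Fin.prod_univ_castSucc]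
    have e1 : (Fin.snoc (α := fun p : Fin (n + 2) => Fin (N p)) k i) (Fin.last (n + 1)) = i :=
      Fin.snoc_last ..
    have e2 : ∀ p : Fin (n + 1),
        (Fin.snoc (α := fun p : Fin (n + 2) => Fin (N p)) k i) p.castSucc = k p :=
      fun p => Fin.snoc_castSucc ..
    have e3 : ∀ p : Fin n,
        (Fin.snoc (α := fun p : Fin (n + 2) => Fin (N p)) k i) p.castSucc.succ = k p.succ :=
      fun p => e2 p.succ
    have e4 : (Fin.snoc (α := fun p : Fin (n + 2) => Fin (N p)) k i) (Fin.last n).succ = i :=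
      e1
    simp only [e1, e2, e3, e4]
    ring

/-! ### Normalisation of the categorical and tracing probabilities. -/

lemma sum_G_pos (F : Model X) (p : ℕ) {k : ℕ} (hk : 0 < k) (z : Fin k → X) :
    0 < ∑ i, F.G p (z i) :=
  Finset.sum_pos (fun _ _ => F.G_pos p _) ⟨⟨0, hk⟩, Finset.mem_univ _⟩

lemma catProb_nonneg (F : Model X) (p : ℕ) {k : ℕ} (z : Fin k → X) (j : Fin k) :
    0 ≤ catProb F p z j :=
  div_nonneg (F.G_pos p _).le (Finset.sum_nonneg fun _ _ => (F.G_pos p _).le)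

lemma sum_catProb (F : Model X) (p : ℕ) {k : ℕ} (hk : 0 < k) (z : Fin k → X) :
    ∑ j, catProb F p z j = 1 := by
  unfold catProb
  rw [← Finset.sum_div, div_self (sum_G_pos F p hk z).ne']

lemma traceProb₁_nonneg {N : ℕ → ℕ} {n : ℕ} (s : System X N n) (k : Lineage N n) :
    0 ≤ traceProb₁ s k :=
  mul_nonneg (by positivity) (Finset.prod_nonneg fun p _ => by split_ifs <;> simp)

lemma traceProb₂_nonneg (F : Model X) {N : ℕ → ℕ} {n : ℕ} (s : System X N n)
    (k k' : Lineage N n) : 0 ≤ traceProb₂ F s k k' := by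
  refine mul_nonneg (by positivity) (Finset.prod_nonneg fun p _ => ?_)
  split_ifs
  · exact catProb_nonneg ..
  · simp
  · simp

lemma sum_traceProb₁ {N : ℕ → ℕ} {n : ℕ} (hN : 0 < N n) (s : System X N n) :
    ∑ k, traceProb₁ s k = 1 := by
  have := sum_lineage_chain (N := N) (n := n) (fun p i j => if j = s.1 p i then (1 : ℝ) else 0)
    (fun p i => by simp) (fun _ => (N n : ℝ)⁻¹)
  refine this.trans ?_
  have : (N n : ℝ) ≠ 0 := by positivity
  simp [this]

/-- Once `k` is fixed, the second lineage is again a backward Markov chain, with a transition that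
switches to the categorical law at the state `k p.succ`. -/
lemma sum_traceProb₂ (F : Model X) {N : ℕ → ℕ} {n : ℕ} (hN : ∀ p ≤ n, 0 < N p) (s : System X N n)
    (k : Lineage N n) : ∑ k', traceProb₂ F s k k' = 1 := by
  have := sum_lineage_chain (N := N) (n := n)
    (fun p i j => if i = k p.succ then catProb F p (s.2 p.castSucc) j
      else if j = s.1 p i then (1 : ℝ) else 0)
    (fun p i => by
      by_cases h : i = k p.succ
      · simp only [h, if_true]
        exact sum_catProb F p (hN p p.2.le) _
      · simp [h]) (fun _ => (N n : ℝ)⁻¹)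
  refine this.trans ?_
  have : (N n : ℝ) ≠ 0 := by have := hN n le_rfl; positivity
  simp [this]

/-! ### Weights of pairs of particles -/

/-- The normalising constant `∏_p N_p^{b_p} (N_p / (N_p - 1))^{1 - b_p}`. -/
noncomputable def bitFactor (N : ℕ → ℕ) {n : ℕ} (b : Fin (n + 1) → Bool) : ℝ :=
  ∏ p : Fin (n + 1), if b p then (N p : ℝ) else (N p : ℝ) / ((N p : ℝ) - 1)

/-- Conditional probability of a pair of lineages, restricted to `𝓘(b)`. -/
noncomputable def coincProb (F : Model X) {N : ℕ → ℕ} {n : ℕ} (b : Fin (n + 1) → Bool)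
    (s : System X N n) (k k' : Lineage N n) : ℝ :=
  (∏ p : Fin (n + 1), if (k p = k' p ↔ b p = true) then 1 else 0) *
    (traceProb₁ s k * traceProb₂ F s k k')

/-- The weight that `μ_b^N` gives to the pair `(ζ_n^i, ζ_n^j)`. -/
noncomputable def pairWeight (F : Model X) {N : ℕ → ℕ} {n : ℕ} (b : Fin (n + 1) → Bool)
    (s : System X N n) (i j : Fin (N n)) : ℝ :=
  bitFactor N b * gammaN F s (fun _ => 1) ^ 2 *
    ∑ k : Lineage N n, ∑ k' : Lineage N n,
      if i = k (Fin.last n) then if j = k' (Fin.last n) then coincProb F b s k k' else 0 else 0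

lemma sum_sum_ite_eq {m : ℕ} (h : Fin m → Fin m → ℝ) (r l : Fin m) :
    (∑ i, ∑ j, if i = r then if j = l then h i j else 0 else 0) = h r l := by
  rw [Fintype.sum_eq_single r fun i hi => by simp [if_neg hi]]
  simp

/-- The summand sees a lineage only through its endpoint, so the sums can be exchanged. This is the
passage between sums over lineages and sums over particles, used for the recursion of the weights
and for the conditional expectation. -/
lemma sum_pairWeight_mul (F : Model X) {N : ℕ → ℕ} {n : ℕ} (b : Fin (n + 1) → Bool)
    (s : System X N n) (h : Fin (N n) → Fin (N n) → ℝ) :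
    ∑ i, ∑ j, pairWeight F b s i j * h i j =
      bitFactor N b * gammaN F s (fun _ => 1) ^ 2 *
        ∑ k : Lineage N n, ∑ k' : Lineage N n,
          coincProb F b s k k' * h (k (Fin.last n)) (k' (Fin.last n)) := by
  unfold pairWeight
  simp only [mul_assoc, ← Finset.mul_sum]
  congr 2
  simp only [Finset.sum_mul]
  rw [Finset.sum_congr rfl fun i _ => Finset.sum_comm, Finset.sum_comm]
  refine Finset.sum_congr rfl fun k _ => ?_
  rw [Finset.sum_congr rfl fun i _ => Finset.sum_comm, Finset.sum_comm]
  refine Finset.sum_congr rfl fun k' _ => ?_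
  simp only [ite_mul, zero_mul]
  exact sum_sum_ite_eq (fun i j => coincProb F b s k k' * h i j) _ _

/-- One step of the recursion for the weights: `w` are the weights at time `p`, `z` the particles
at time `p` and `a` the ancestor indices of the `m` particles at time `p + 1`. -/
noncomputable def stepWeight (F : Model X) (p : ℕ) {k m : ℕ} (bit : Bool) (z : Fin k → X)
    (w : Fin k → Fin k → ℝ) (a : Fin m → Fin k) (i j : Fin m) : ℝ :=
  if bit then
    if i = j then (∑ r, F.G p (z r)) / m * ∑ l, w (a i) l * F.G p (z l) else 0
  else
    if i = j then 0 else (∑ r, F.G p (z r)) ^ 2 / (m * (m - 1)) * w (a i) (a j)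

lemma bitFactor_succ (N : ℕ → ℕ) {n : ℕ} (b : Fin (n + 2) → Bool) :
    bitFactor N b = bitFactor N (Fin.init b) * if b (Fin.last (n + 1)) then (N (n + 1) : ℝ)
      else (N (n + 1) : ℝ) / ((N (n + 1) : ℝ) - 1) := by
  unfold bitFactor
  rw [Fin.prod_univ_castSucc]
  rfl

lemma extend_fst_castSucc {N : ℕ → ℕ} {n : ℕ} (s : System X N n)
    (y : Fin (N (n + 1)) → Fin (N n) × X) (p : Fin n) :
    (s.extend y).1 p.castSucc = s.1 p :=
  Fin.snoc_castSucc (α := fun p : Fin (n + 1) => Fin (N (p + 1)) → Fin (N p)) ..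

lemma extend_fst_last {N : ℕ → ℕ} {n : ℕ} (s : System X N n)
    (y : Fin (N (n + 1)) → Fin (N n) × X) :
    (s.extend y).1 (Fin.last n) = fun i => (y i).1 :=
  Fin.snoc_last (α := fun p : Fin (n + 1) => Fin (N (p + 1)) → Fin (N p)) ..

lemma extend_snd_castSucc {N : ℕ → ℕ} {n : ℕ} (s : System X N n)
    (y : Fin (N (n + 1)) → Fin (N n) × X) (p : Fin (n + 1)) :
    (s.extend y).2 p.castSucc = s.2 p :=
  Fin.snoc_castSucc (α := fun p : Fin (n + 2) => Fin (N p) → X) ..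

lemma extend_snd_last {N : ℕ → ℕ} {n : ℕ} (s : System X N n)
    (y : Fin (N (n + 1)) → Fin (N n) × X) :
    (s.extend y).2 (Fin.last (n + 1)) = fun i => (y i).2 :=
  Fin.snoc_last (α := fun p : Fin (n + 2) => Fin (N p) → X) ..

lemma gammaN_one (F : Model X) {N : ℕ → ℕ} {n : ℕ} (hN : 0 < N n) (s : System X N n) :
    gammaN F s (fun _ => 1) = ∏ p : Fin n, etaN s p.castSucc (F.G p) := by
  have : (N n : ℝ) ≠ 0 := by positivity
  simp [gammaN, etaN, this]

lemma gammaN_one_extend (F : Model X) {N : ℕ → ℕ} {n : ℕ} (hN : 0 < N n) (hN' : 0 < N (n + 1))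
    (s : System X N n) (y : Fin (N (n + 1)) → Fin (N n) × X) :
    gammaN F (s.extend y) (fun _ => 1) =
      gammaN F s (fun _ => 1) * ((N n : ℝ)⁻¹ * ∑ r, F.G n (s.2 (Fin.last n) r)) := by
  rw [gammaN_one F hN, gammaN_one F hN', Fin.prod_univ_castSucc]
  simp only [etaN, extend_snd_castSucc]
  rfl

/-- Each tracing probability starts uniformly at the last time; adding a time replaces `1 / N n` by
`1 / N (n + 1)` in both, whence the squared ratio. -/
lemma coincProb_snoc (F : Model X) {N : ℕ → ℕ} {n : ℕ} (hN : 0 < N n)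
    (b : Fin (n + 2) → Bool) (s : System X N n) (y : Fin (N (n + 1)) → Fin (N n) × X)
    (k k' : Lineage N n) (i j : Fin (N (n + 1))) :
    coincProb F b (s.extend y) (Fin.snoc (α := fun p : Fin (n + 2) => Fin (N p)) k i)
        (Fin.snoc (α := fun p : Fin (n + 2) => Fin (N p)) k' j) =
      coincProb F (Fin.init b) s k k' * (((N n : ℝ) / N (n + 1)) ^ 2 *
        ((if (i = j ↔ b (Fin.last (n + 1)) = true) then 1 else 0) *
          (if k (Fin.last n) = (y i).1 then 1 else 0) *
          (if j = i then catProb F n (s.2 (Fin.last n)) (k' (Fin.last n))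
            else if k' (Fin.last n) = (y j).1 then 1 else 0))) := by
  have e1 : ∀ (k : Lineage N n) i, (Fin.snoc (α := fun p : Fin (n + 2) => Fin (N p)) k i)
      (Fin.last (n + 1)) = i := fun k i => Fin.snoc_last ..
  have e2 : ∀ (k : Lineage N n) i (p : Fin (n + 1)),
      (Fin.snoc (α := fun p : Fin (n + 2) => Fin (N p)) k i) p.castSucc = k p :=
    fun k i p => Fin.snoc_castSucc ..
  have e3 : ∀ (k : Lineage N n) i (p : Fin n),
      (Fin.snoc (α := fun p : Fin (n + 2) => Fin (N p)) k i) p.castSucc.succ = k p.succ :=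
    fun k i p => e2 k i p.succ
  have e4 : ∀ (k : Lineage N n) i, (Fin.snoc (α := fun p : Fin (n + 2) => Fin (N p)) k i)
      (Fin.last n).succ = i := e1
  have h0 : (N n : ℝ) ≠ 0 := by positivity
  have t1 : traceProb₁ (s.extend y) (Fin.snoc (α := fun p : Fin (n + 2) => Fin (N p)) k i) =
      (N n : ℝ) / N (n + 1) * traceProb₁ s k * (if k (Fin.last n) = (y i).1 then 1 else 0) := by
    unfold traceProb₁
    rw [Fin.prod_univ_castSucc]
    simp only [e2, e3, e4, extend_fst_castSucc, extend_fst_last]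
    field_simp
  have t2 : traceProb₂ F (s.extend y) (Fin.snoc (α := fun p : Fin (n + 2) => Fin (N p)) k i)
      (Fin.snoc (α := fun p : Fin (n + 2) => Fin (N p)) k' j) =
      (N n : ℝ) / N (n + 1) * traceProb₂ F s k k' *
        (if j = i then catProb F n (s.2 (Fin.last n)) (k' (Fin.last n))
            else if k' (Fin.last n) = (y j).1 then 1 else 0) := by
    unfold traceProb₂
    rw [Fin.prod_univ_castSucc]
    simp only [e2, e3, e4, extend_fst_castSucc, extend_fst_last, extend_snd_castSucc]
    simp only [Fin.val_last, Fin.val_castSucc]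
    field_simp
  have t3 : (∏ p : Fin (n + 2), if ((Fin.snoc (α := fun p : Fin (n + 2) => Fin (N p)) k i) p =
        (Fin.snoc (α := fun p : Fin (n + 2) => Fin (N p)) k' j) p ↔ b p = true)
        then (1 : ℝ) else 0) =
      (∏ p : Fin (n + 1), if (k p = k' p ↔ Fin.init b p = true) then (1 : ℝ) else 0) *
        (if (i = j ↔ b (Fin.last (n + 1)) = true) then 1 else 0) := by
    rw [Fin.prod_univ_castSucc]
    simp only [e1, e2]
    rfl
  unfold coincProb
  rw [t1, t2, t3]
  ring

/-- The weights satisfy the recursion given by `stepWeight`. -/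
lemma pairWeight_extend (F : Model X) {N : ℕ → ℕ} {n : ℕ} (hN : 0 < N n) (hN' : 2 ≤ N (n + 1))
    (b : Fin (n + 2) → Bool) (s : System X N n) (y : Fin (N (n + 1)) → Fin (N n) × X)
    (i j : Fin (N (n + 1))) :
    pairWeight F b (s.extend y) i j =
      stepWeight F n (b (Fin.last (n + 1))) (s.2 (Fin.last n)) (pairWeight F (Fin.init b) s)
        (fun i => (y i).1) i j := by
  have e1 : ∀ (k : Lineage N n) i, (Fin.snoc (α := fun p : Fin (n + 2) => Fin (N p)) k i)
      (Fin.last (n + 1)) = i := fun k i => Fin.snoc_last ..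
  have h0 : (N n : ℝ) ≠ 0 := by positivity
  have h1 : (N (n + 1) : ℝ) ≠ 0 := by positivity
  have h2 : (N (n + 1) : ℝ) - 1 ≠ 0 := by
    have : (2 : ℝ) ≤ N (n + 1) := by exact_mod_cast hN'
    linarith
  have hS := (sum_G_pos F n hN (s.2 (Fin.last n))).ne'
  conv_lhs => unfold pairWeight
  simp only [sum_lineage_succ, e1, coincProb_snoc F hN]
  have h3 : ∀ k : Lineage N n, (∑ i', ∑ k' : Lineage N n, ∑ j',
      if i = i' then if j = j' then coincProb F (Fin.init b) s k k' * (((N n : ℝ) / N (n + 1)) ^ 2 *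
        ((if (i' = j' ↔ b (Fin.last (n + 1)) = true) then 1 else 0) *
          (if k (Fin.last n) = (y i').1 then 1 else 0) *
          (if j' = i' then catProb F n (s.2 (Fin.last n)) (k' (Fin.last n))
            else if k' (Fin.last n) = (y j').1 then 1 else 0))) else 0 else 0) =
      ∑ k' : Lineage N n, coincProb F (Fin.init b) s k k' * (((N n : ℝ) / N (n + 1)) ^ 2 *
        ((if (i = j ↔ b (Fin.last (n + 1)) = true) then 1 else 0) *
          (if k (Fin.last n) = (y i).1 then 1 else 0) *
          (if j = i then catProb F n (s.2 (Fin.last n)) (k' (Fin.last n))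
            else if k' (Fin.last n) = (y j).1 then 1 else 0))) := by
    intro k
    rw [Fintype.sum_eq_single i fun i' hi => by simp [if_neg hi.symm]]
    refine Finset.sum_congr rfl fun k' _ => ?_
    rw [Fintype.sum_eq_single j fun j' hj => by simp [if_neg hj.symm]]
    simp
  simp only [h3]
  have h4 := sum_pairWeight_mul F (Fin.init b) s (fun r l => (((N n : ℝ) / N (n + 1)) ^ 2 *
        ((if (i = j ↔ b (Fin.last (n + 1)) = true) then 1 else 0) *
          (if r = (y i).1 then 1 else 0) *
          (if j = i then catProb F n (s.2 (Fin.last n)) l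
            else if l = (y j).1 then 1 else 0))))
  rw [bitFactor_succ, gammaN_one_extend F hN (by omega)]
  set c : ℝ := if b (Fin.last (n + 1)) then (N (n + 1) : ℝ)
      else (N (n + 1) : ℝ) / ((N (n + 1) : ℝ) - 1) with hc
  set S := ∑ r, F.G n (s.2 (Fin.last n) r) with hSdef
  have h5 : ∀ B Γ T : ℝ, B * c * (Γ * ((N n : ℝ)⁻¹ * S)) ^ 2 * T =
      c * ((N n : ℝ)⁻¹ * S) ^ 2 * (B * Γ ^ 2 * T) := fun B Γ T => by ring
  rw [h5, ← h4]
  -- The powers of `N n` cancel and leave `c * S ^ 2 / N (n + 1) ^ 2`. With bit 0, `c = m / (m - 1)`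
  -- gives `S ^ 2 / (m * (m - 1))`; with bit 1, `c = m` and the categorical probability `G / S`
  -- absorbs one factor `m` and one factor `S`.
  have h6 : ∀ v : Fin (N n) → Fin (N n) → ℝ, c * ((N n : ℝ)⁻¹ * S) ^ 2 *
      ∑ r, ∑ l, v r l * (((N n : ℝ) / N (n + 1)) ^ 2 *
        ((if (i = j ↔ b (Fin.last (n + 1)) = true) then 1 else 0) *
          (if r = (y i).1 then 1 else 0) *
          (if j = i then catProb F n (s.2 (Fin.last n)) l
            else if l = (y j).1 then 1 else 0))) =
      stepWeight F n (b (Fin.last (n + 1))) (s.2 (Fin.last n)) v (fun i => (y i).1) i j := by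
    intro v
    rw [Fintype.sum_eq_single (y i).1 fun r hr => by simp [if_neg hr]]
    unfold stepWeight
    by_cases hb : b (Fin.last (n + 1)) = true
    · by_cases hij : i = j
      · subst hij
        simp only [hc, hb, if_true, iff_self, one_mul, mul_one]
        unfold catProb
        simp only [← hSdef, Finset.mul_sum]
        refine Finset.sum_congr rfl fun l _ => ?_
        field_simp
      · simp [hb, hij]
    · by_cases hij : i = j
      · subst hij
        simp [hb]
      · simp [hb, hij, Ne.symm hij, hc]
        field_simp
        exact mul_comm _ _
  exact h6 _

/-! ### The Efron–Stein inequality -/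

section EfronStein

lemma integrable_of_measurable_of_bound {α : Type*} [MeasurableSpace α] {μ : Measure α}
    [IsFiniteMeasure μ] {f : α → ℝ} (hf : Measurable f) {C : ℝ} (hC : ∀ x, |f x| ≤ C) :
    Integrable f μ :=
  Integrable.of_bound hf.aestronglyMeasurable C (ae_of_all _ hC)

lemma abs_integral_le_of_bound {α : Type*} [MeasurableSpace α] {μ : Measure α}
    [IsProbabilityMeasure μ] {f : α → ℝ} {C : ℝ} (hC : ∀ x, |f x| ≤ C) :
    |∫ x, f x ∂μ| ≤ C := by
  have := norm_integral_le_of_norm_le_const (μ := μ) (f := f) (ae_of_all _ hC)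
  simpa using this

lemma sq_abs_le {a C : ℝ} (h : |a| ≤ C) : |a ^ 2| ≤ C ^ 2 := by
  rw [abs_pow]
  exact pow_le_pow_left₀ (abs_nonneg _) h 2

/-- Bias–variance decomposition. It gives Jensen's inequality below, the conditional step of
Efron–Stein, and the split of the mean square error at each time. -/
lemma integral_sub_const_sq {α : Type*} [MeasurableSpace α] {μ : Measure α}
    [IsProbabilityMeasure μ] {f : α → ℝ} (hf : Measurable f) {C : ℝ} (hC : ∀ x, |f x| ≤ C)
    (c : ℝ) : ∫ x, (f x - c) ^ 2 ∂μ = ∫ x, f x ^ 2 ∂μ - (∫ x, f x ∂μ) ^ 2 +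
      (∫ x, f x ∂μ - c) ^ 2 := by
  have h1 : Integrable f μ := integrable_of_measurable_of_bound hf hC
  have h2 : Integrable (fun x => f x ^ 2) μ :=
    integrable_of_measurable_of_bound (hf.pow_const 2) fun x => sq_abs_le (hC x)
  have : ∀ x, (f x - c) ^ 2 = f x ^ 2 - 2 * c * f x + c ^ 2 := fun x => by ring
  simp_rw [this]
  have h3 : Integrable (fun x => f x ^ 2 - 2 * c * f x) μ := h2.sub (h1.const_mul _)
  rw [integral_add h3 (integrable_const _), integral_sub h2 (h1.const_mul _), integral_const_mul]
  simp
  ring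

lemma sq_integral_le {α : Type*} [MeasurableSpace α] {μ : Measure α}
    [IsProbabilityMeasure μ] {f : α → ℝ} (hf : Measurable f) {C : ℝ} (hC : ∀ x, |f x| ≤ C) :
    (∫ x, f x ∂μ) ^ 2 ≤ ∫ x, f x ^ 2 ∂μ := by
  have h := integral_sub_const_sq (μ := μ) hf hC (∫ x, f x ∂μ)
  have : 0 ≤ ∫ x, (f x - ∫ x, f x ∂μ) ^ 2 ∂μ := integral_nonneg fun x => sq_nonneg _
  rw [sub_self] at h
  linarith [h, this]

lemma integral_pi_succ {α : Type*} [MeasurableSpace α] (μ : Measure α) [IsProbabilityMeasure μ]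
    {l : ℕ} {f : (Fin (l + 1) → α) → ℝ} (hf : Measurable f) {C : ℝ} (hC : ∀ x, |f x| ≤ C) :
    ∫ y, f y ∂(Measure.pi fun _ => μ) =
      ∫ y, ∫ a, f (Fin.cons a y) ∂μ ∂(Measure.pi fun _ : Fin l => μ) := by
  have h := (measurePreserving_piFinSuccAbove (fun _ : Fin (l + 1) => μ) 0).symm
  rw [← h.integral_comp' f]
  have hm : Measurable fun x => f ((MeasurableEquiv.piFinSuccAbove (fun _ => α) 0).symm x) :=
    hf.comp (MeasurableEquiv.measurable _)
  rw [integral_prod_symm _ (integrable_of_measurable_of_bound hm fun x => hC _)]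
  simp [MeasurableEquiv.piFinSuccAbove, Fin.insertNthEquiv]

lemma measurable_cons {α : Type*} [MeasurableSpace α] {l : ℕ} :
    Measurable fun x : α × (Fin l → α) => (Fin.cons x.1 x.2 : Fin (l + 1) → α) := by
  refine measurable_pi_iff.2 fun i => ?_
  refine Fin.cases ?_ (fun j => ?_) i
  · exact measurable_fst
  · exact (measurable_pi_apply j).comp measurable_snd

/-- The Efron–Stein inequality: if `g i` does not depend on the `i`-th coordinate, then
`Var f ≤ ∑ i, E (f - g i)²` under a product measure. -/
theorem efronStein {α : Type*} [MeasurableSpace α] (μ : Measure α) [IsProbabilityMeasure μ]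
    {l : ℕ} {f : (Fin l → α) → ℝ} (hf : Measurable f) {C : ℝ} (hC : ∀ x, |f x| ≤ C)
    {g : Fin l → (Fin l → α) → ℝ} (hg : ∀ i, Measurable (g i)) (hgC : ∀ i x, |g i x| ≤ C)
    (hgi : ∀ i x a, g i (Function.update x i a) = g i x) :
    ∫ y, f y ^ 2 ∂(Measure.pi fun _ => μ) - (∫ y, f y ∂(Measure.pi fun _ => μ)) ^ 2 ≤
      ∑ i, ∫ y, (f y - g i y) ^ 2 ∂(Measure.pi fun _ => μ) := by
  induction l with
  | zero =>
    have : ∀ y, f y = f finZeroElim := fun y => by rw [Subsingleton.elim y finZeroElim]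
    simp [this]
  | succ l ih =>
    have hfc : Measurable fun x : α × (Fin l → α) => f (Fin.cons x.1 x.2) :=
      hf.comp measurable_cons
    have hgc : ∀ i, Measurable fun x : α × (Fin l → α) => g i (Fin.cons x.1 x.2) :=
      fun i => (hg i).comp measurable_cons
    have hfa : ∀ y, Measurable fun a => f (Fin.cons a y) := fun y =>
      hfc.comp (measurable_id.prodMk measurable_const)
    have hga : ∀ i y, Measurable fun a => g i (Fin.cons a y) := fun i y =>
      (hgc i).comp (measurable_id.prodMk measurable_const)
    have hint : ∀ {k : α × (Fin l → α) → ℝ}, Measurable k →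
        Measurable fun y => ∫ a, k (a, y) ∂μ := fun {k} hk =>
      (hk.stronglyMeasurable.integral_prod_left' (μ := μ)).measurable
    -- `H` averages out coordinate 0, so `Var f = E[Var(f | y)] + Var H`. The first term is bounded
    -- by the summand `i = 0`, and the induction hypothesis for `H` and the averages `g'` handles
    -- the second.
    set H : (Fin l → α) → ℝ := fun y => ∫ a, f (Fin.cons a y) ∂μ with hH
    have hHm : Measurable H := hint hfc
    have hHC : ∀ y, |H y| ≤ C := fun y => abs_integral_le_of_bound fun a => hC _
    set g' : Fin l → (Fin l → α) → ℝ := fun i y => ∫ a, g i.succ (Fin.cons a y) ∂μ with hg'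
    have ih' := ih hHm hHC (g := g') (fun i => hint (hgc i.succ))
      (fun i y => abs_integral_le_of_bound fun a => hgC _ _) (fun i x a => by
        simp only [hg']
        congr 1
        ext c
        rw [Fin.cons_update, hgi])
    have hsq : ∀ i x, |(f x - g i x) ^ 2| ≤ (C + C) ^ 2 := fun i x =>
      sq_abs_le ((abs_sub _ _).trans (add_le_add (hC x) (hgC i x)))
    have hdm : ∀ i, Measurable fun x => (f x - g i x) ^ 2 := fun i => (hf.sub (hg i)).pow_const 2
    have hdi : ∀ i, Integrable (fun y => ∫ a, (f (Fin.cons a y) - g i (Fin.cons a y)) ^ 2 ∂μ)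
        (Measure.pi fun _ : Fin l => μ) := fun i =>
      integrable_of_measurable_of_bound (hint ((hfc.sub (hgc i)).pow_const 2))
        fun y => abs_integral_le_of_bound fun a => hsq i _
    have hf2i : Integrable (fun y => ∫ a, f (Fin.cons a y) ^ 2 ∂μ)
        (Measure.pi fun _ : Fin l => μ) :=
      integrable_of_measurable_of_bound (hint (hfc.pow_const 2))
        fun y => abs_integral_le_of_bound fun a => sq_abs_le (hC _)
    have hH2i : Integrable (fun y => H y ^ 2) (Measure.pi fun _ : Fin l => μ) :=
      integrable_of_measurable_of_bound (hHm.pow_const 2) fun y => sq_abs_le (hHC y)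
    rw [Fin.sum_univ_succ, integral_pi_succ μ hf hC,
      integral_pi_succ μ (hf.pow_const 2) (fun x => sq_abs_le (hC x)),
      integral_pi_succ μ (hdm 0) (hsq 0)]
    simp_rw [fun i : Fin l => integral_pi_succ μ (hdm i.succ) (hsq i.succ)]
    -- For fixed `y`, `g 0` is constant in coordinate 0, and the variance is the least mean square
    -- distance to a constant.
    have hA : ∫ y, ∫ a, f (Fin.cons a y) ^ 2 ∂μ ∂(Measure.pi fun _ : Fin l => μ) -
        ∫ y, H y ^ 2 ∂(Measure.pi fun _ : Fin l => μ) ≤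
        ∫ y, ∫ a, (f (Fin.cons a y) - g 0 (Fin.cons a y)) ^ 2 ∂μ ∂(Measure.pi fun _ => μ) := by
      rw [← integral_sub hf2i hH2i]
      refine integral_mono (hf2i.sub hH2i) (hdi 0) fun y => ?_
      obtain ⟨a₀⟩ : Nonempty α := nonempty_of_isProbabilityMeasure μ
      have hc : ∀ a, g 0 (Fin.cons a y) = g 0 (Fin.cons a₀ y) := fun a => by
        rw [← hgi 0 (Fin.cons a₀ y) a, Fin.update_cons_zero]
      simp only [hc]
      rw [integral_sub_const_sq (hfa y) (fun a => hC _)]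
      simp only [hH]
      linarith [sq_nonneg ((∫ a, f (Fin.cons a y) ∂μ) - g 0 (Fin.cons a₀ y))]
    -- Averaging over coordinate 0 contracts squared distances, by Jensen.
    have hB : ∀ i : Fin l, ∫ y, (H y - g' i y) ^ 2 ∂(Measure.pi fun _ : Fin l => μ) ≤
        ∫ y, ∫ a, (f (Fin.cons a y) - g i.succ (Fin.cons a y)) ^ 2 ∂μ
          ∂(Measure.pi fun _ => μ) := by
      intro i
      refine integral_mono_of_nonneg (ae_of_all _ fun y => sq_nonneg _) (hdi i.succ)
        (ae_of_all _ fun y => ?_)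
      simp only [hH, hg']
      rw [← integral_sub (integrable_of_measurable_of_bound (hfa y) fun a => hC _)
        (integrable_of_measurable_of_bound (hga i.succ y) fun a => hgC _ _)]
      exact sq_integral_le ((hfa y).sub (hga i.succ y)) (C := C + C) fun a =>
        (abs_sub _ _).trans (add_le_add (hC _) (hgC _ _))
    have hB' := Finset.sum_le_sum fun i (_ : i ∈ Finset.univ) => hB i
    linarith

end EfronStein

/-! ### Marginals of product measures -/

section Marginals

variable {α ι : Type*} [MeasurableSpace α] [Fintype ι] (μ : Measure α) [IsProbabilityMeasure μ]

lemma integral_pi_eval (i : ι) {h : α → ℝ} (hh : Measurable h) :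
    ∫ y, h (y i) ∂(Measure.pi fun _ : ι => μ) = ∫ a, h a ∂μ := by
  have h1 := integral_map (μ := Measure.pi fun _ : ι => μ) (measurable_pi_apply i).aemeasurable
    (f := h) hh.aestronglyMeasurable
  exact h1.symm.trans (by
    rw [show (Measure.pi fun _ : ι => μ).map (fun y => y i) = μ from
      (measurePreserving_eval (fun _ : ι => μ) i).map_eq])

lemma map_pi_eval_prod {i j : ι} (hij : i ≠ j) :
    (Measure.pi fun _ : ι => μ).map (fun y => (y i, y j)) = μ.prod μ := by
  have h := (iIndepFun_pi (μ := fun _ : ι => μ) (X := fun _ a => a)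
    (fun _ => aemeasurable_id)).indepFun hij
  rw [(indepFun_iff_map_prod_eq_prod_map_map (measurable_pi_apply i).aemeasurable
    (measurable_pi_apply j).aemeasurable).1 h]
  congr 1
  · exact (measurePreserving_eval (fun _ : ι => μ) i).map_eq
  · exact (measurePreserving_eval (fun _ : ι => μ) j).map_eq

lemma integral_pi_eval_two {i j : ι} (hij : i ≠ j) {h : α × α → ℝ} (hh : Measurable h) {C : ℝ}
    (hC : ∀ x, |h x| ≤ C) :
    ∫ y, h (y i, y j) ∂(Measure.pi fun _ : ι => μ) = ∫ a, ∫ b, h (a, b) ∂μ ∂μ := by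
  rw [← integral_prod h (integrable_of_measurable_of_bound hh hC), ← map_pi_eval_prod μ hij,
    integral_map ((measurable_pi_apply i).prodMk (measurable_pi_apply j)).aemeasurable
      hh.aestronglyMeasurable]

/-- Needed for the cross terms `w i j * w i k` in the square of a row sum. -/
lemma integral_pi_eval_three {i j k : ι} (hij : i ≠ j) (hik : i ≠ k) (hjk : j ≠ k)
    {h : (α × α) × α → ℝ} (hh : Measurable h) {C : ℝ} (hC : ∀ x, |h x| ≤ C) :
    ∫ y, h ((y i, y j), y k) ∂(Measure.pi fun _ : ι => μ) =
      ∫ a, ∫ b, ∫ c, h ((a, b), c) ∂μ ∂μ ∂μ := by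
  have hm : Measurable fun x : α × α => ∫ c, h (x, c) ∂μ :=
    (hh.stronglyMeasurable.integral_prod_right' (ν := μ)).measurable
  have h1 : Measurable fun y : ι → α => (y i, y j) :=
    (measurable_pi_apply i).prodMk (measurable_pi_apply j)
  have hI := (iIndepFun_pi (μ := fun _ : ι => μ) (X := fun _ a => a)
    (fun _ => aemeasurable_id)).indepFun_prodMk (fun i => measurable_pi_apply i) i j k hik hjk
  have h2 := (indepFun_iff_map_prod_eq_prod_map_map h1.aemeasurable
    (measurable_pi_apply k).aemeasurable).1 hI
  rw [map_pi_eval_prod μ hij, show (Measure.pi fun _ : ι => μ).map (fun y => y k) = μ from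
    (measurePreserving_eval (fun _ : ι => μ) k).map_eq] at h2
  rw [← integral_prod (fun x : α × α => ∫ c, h (x, c) ∂μ)
    (integrable_of_measurable_of_bound hm fun x => abs_integral_le_of_bound fun c => hC _),
    ← integral_prod h (integrable_of_measurable_of_bound hh hC), ← h2,
    integral_map (h1.prodMk (measurable_pi_apply k)).aemeasurable hh.aestronglyMeasurable]

end Marginals

/-! ### The kernels of the particle system -/

lemma catKernel_apply (F : Model X) (p k : ℕ) (z : Fin k → X) :
    catKernel F p k z = ∑ j, ENNReal.ofReal (catProb F p z j) • Measure.dirac j := rfl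

lemma integral_catKernel (F : Model X) (p : ℕ) {k : ℕ} (z : Fin k → X) (f : Fin k → ℝ) :
    ∫ j, f j ∂(catKernel F p k z) = ∑ j, catProb F p z j * f j := by
  rw [catKernel_apply, integral_finsetSum_measure fun j _ =>
    (integrable_dirac (by simp)).smul_measure ENNReal.ofReal_ne_top]
  refine Finset.sum_congr rfl fun j _ => ?_
  rw [integral_smul_measure, integral_dirac, ENNReal.toReal_ofReal (catProb_nonneg ..), smul_eq_mul]

lemma isProbabilityMeasure_catKernel (F : Model X) (p : ℕ) {k : ℕ} (hk : 0 < k) (z : Fin k → X) :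
    IsProbabilityMeasure (catKernel F p k z) := by
  constructor
  rw [catKernel_apply]
  simp only [Measure.coe_finsetSum, Finset.sum_apply, Measure.smul_apply, smul_eq_mul,
    measure_univ, mul_one]
  rw [← ENNReal.ofReal_sum_of_nonneg fun j _ => catProb_nonneg .., sum_catProb F p hk,
    ENNReal.ofReal_one]

lemma isMarkovKernel_offspringKernel (F : Model X) (p : ℕ) {k : ℕ} (hk : 0 < k) :
    IsMarkovKernel (offspringKernel F p k) := by
  have : IsMarkovKernel (catKernel F p k) := ⟨isProbabilityMeasure_catKernel F p hk⟩
  unfold offspringKernel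
  infer_instance

lemma integral_offspringKernel (F : Model X) (p : ℕ) {k : ℕ} (z : Fin k → X)
    {f : Fin k × X → ℝ} (hf : Measurable f) {C : ℝ} (hC : ∀ x, |f x| ≤ C) :
    ∫ y, f y ∂(offspringKernel F p k z) =
      ∑ j, catProb F p z j * ∫ x, f (j, x) ∂(F.M p (z j)) := by
  unfold offspringKernel
  rw [integral_compProd (integrable_of_measurable_of_bound hf hC), integral_catKernel]
  rfl

lemma isMarkovKernel_iidKernel {α β : Type*} [MeasurableSpace α] [MeasurableSpace β]
    (κ : Kernel α β) [IsMarkovKernel κ] (l : ℕ) : IsMarkovKernel (iidKernel κ l) :=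
  ⟨fun a => inferInstanceAs (IsProbabilityMeasure (Measure.pi fun _ => κ a))⟩

lemma measurable_extend {N : ℕ → ℕ} {n : ℕ} :
    Measurable fun y : System X N n × (Fin (N (n + 1)) → Fin (N n) × X) =>
      System.extend y.1 y.2 := by
  refine Measurable.prodMk ?_ ?_
  · refine measurable_pi_iff.2 fun p => ?_
    refine Fin.lastCases ?_ (fun q => ?_) p
    · simp only [Fin.snoc_last]
      exact measurable_pi_iff.2 fun i => measurable_fst.comp
        ((measurable_pi_apply i).comp measurable_snd)
    · simp only [Fin.snoc_castSucc]
      exact (measurable_pi_apply q).comp (measurable_fst.comp measurable_fst)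
  · refine measurable_pi_iff.2 fun p => ?_
    refine Fin.lastCases ?_ (fun q => ?_) p
    · simp only [Fin.snoc_last]
      exact measurable_pi_iff.2 fun i => measurable_snd.comp
        ((measurable_pi_apply i).comp measurable_snd)
    · simp only [Fin.snoc_castSucc]
      exact (measurable_pi_apply q).comp (measurable_snd.comp measurable_fst)

lemma measurable_initial {N : ℕ → ℕ} : Measurable fun z : Fin (N 0) → X =>
    ((finZeroElim, Fin.cons z finZeroElim) : System X N 0) := by
  refine Measurable.prodMk measurable_const (measurable_pi_iff.2 fun p => ?_)
  refine Fin.cases ?_ (fun q => q.elim0) p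
  exact measurable_id

lemma isProbabilityMeasure_particleLaw (F : Model X) (N : ℕ → ℕ) (n : ℕ)
    (hN : ∀ p < n, 0 < N p) : IsProbabilityMeasure (particleLaw F N n) := by
  induction n with
  | zero => exact Measure.isProbabilityMeasure_map measurable_initial.aemeasurable
  | succ n ih =>
    have := ih fun p hp => hN p (by omega)
    have := isMarkovKernel_offspringKernel F n (hN n (by omega))
    have := isMarkovKernel_iidKernel (offspringKernel F n (N n)) (N (n + 1))
    exact Measure.isProbabilityMeasure_map measurable_extend.aemeasurable

lemma integral_particleLaw_zero (F : Model X) (N : ℕ → ℕ) {f : System X N 0 → ℝ}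
    (hf : Measurable f) :
    ∫ s, f s ∂(particleLaw F N 0) =
      ∫ z, f (finZeroElim, Fin.cons z finZeroElim) ∂(Measure.pi fun _ : Fin (N 0) => F.M₀) := by
  exact integral_map (μ := Measure.pi fun _ : Fin (N 0) => F.M₀) measurable_initial.aemeasurable
    hf.aestronglyMeasurable

/-- The law of the ancestor indices and the particles at time `n + 1` given the particle system up
to time `n`. -/
noncomputable def stepLaw (F : Model X) {N : ℕ → ℕ} {n : ℕ} (s : System X N n) :
    Measure (Fin (N (n + 1)) → Fin (N n) × X) :=
  Measure.pi fun _ => offspringKernel F n (N n) (s.2 (Fin.last n))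

lemma isProbabilityMeasure_stepLaw (F : Model X) {N : ℕ → ℕ} {n : ℕ} (hN : 0 < N n)
    (s : System X N n) : IsProbabilityMeasure (stepLaw F s) := by
  have := isMarkovKernel_offspringKernel F n hN
  unfold stepLaw
  infer_instance

lemma integral_particleLaw_succ (F : Model X) (N : ℕ → ℕ) (n : ℕ) (hN : ∀ p ≤ n, 0 < N p)
    {f : System X N (n + 1) → ℝ} (hf : Measurable f) {C : ℝ} (hC : ∀ x, |f x| ≤ C) :
    ∫ s, f s ∂(particleLaw F N (n + 1)) =
      ∫ s, ∫ y, f (s.extend y) ∂(stepLaw F s) ∂(particleLaw F N n) := by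
  have := isProbabilityMeasure_particleLaw F N n fun p hp => hN p hp.le
  have := isMarkovKernel_offspringKernel F n (hN n le_rfl)
  have := isMarkovKernel_iidKernel (offspringKernel F n (N n)) (N (n + 1))
  rw [particleLaw, integral_map measurable_extend.aemeasurable hf.aestronglyMeasurable]
  exact Measure.integral_compProd
    (integrable_of_measurable_of_bound (hf.comp measurable_extend) fun x => hC _)

lemma measurable_integral_stepLaw (F : Model X) (N : ℕ → ℕ) (n : ℕ)
    {f : System X N (n + 1) → ℝ} (hf : Measurable f) (hN : 0 < N n) :
    Measurable fun s => ∫ y, f (s.extend y) ∂(stepLaw F s) := by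
  have := isMarkovKernel_offspringKernel F n hN
  have := isMarkovKernel_iidKernel (offspringKernel F n (N n)) (N (n + 1))
  exact ((hf.comp measurable_extend).stronglyMeasurable.integral_kernel_prod_right'
    (κ := (iidKernel (offspringKernel F n (N n)) (N (n + 1))).comap
          (fun s : System X N n => s.2 (Fin.last n))
          ((measurable_pi_apply _).comp measurable_snd))).measurable

/-! ### The tracing kernel and the conditional expectation -/

lemma isMarkovKernel_traceKernel (F : Model X) (N : ℕ → ℕ) (n : ℕ) (hN : ∀ p ≤ n, 0 < N p) :
    IsMarkovKernel (traceKernel F N n) := by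
  refine ⟨fun s => ⟨?_⟩⟩
  change (∑ k : Lineage N n × Lineage N n,
    ENNReal.ofReal (traceProb₁ s k.1 * traceProb₂ F s k.1 k.2) • Measure.dirac k :
      Measure (Lineage N n × Lineage N n)) _ = _
  simp only [Measure.coe_finsetSum, Finset.sum_apply, Measure.smul_apply, smul_eq_mul,
    measure_univ, mul_one]
  rw [← ENNReal.ofReal_sum_of_nonneg fun k _ =>
    mul_nonneg (traceProb₁_nonneg ..) (traceProb₂_nonneg ..), Fintype.sum_prod_type]
  simp_rw [← Finset.mul_sum, sum_traceProb₂ F hN, mul_one, sum_traceProb₁ (hN n le_rfl)]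
  exact ENNReal.ofReal_one

lemma integral_traceKernel (F : Model X) {N : ℕ → ℕ} {n : ℕ} (s : System X N n)
    (f : Lineage N n × Lineage N n → ℝ) :
    ∫ k, f k ∂(traceKernel F N n s) =
      ∑ k : Lineage N n, ∑ k' : Lineage N n,
        traceProb₁ s k * traceProb₂ F s k k' * f (k, k') := by
  change ∫ k, f k ∂(∑ k : Lineage N n × Lineage N n,
    ENNReal.ofReal (traceProb₁ s k.1 * traceProb₂ F s k.1 k.2) • Measure.dirac k :
      Measure (Lineage N n × Lineage N n)) = _
  rw [integral_finsetSum_measure fun j _ =>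
    (integrable_dirac (by simp)).smul_measure ENNReal.ofReal_ne_top, Fintype.sum_prod_type]
  refine Finset.sum_congr rfl fun k _ => Finset.sum_congr rfl fun k' _ => ?_
  rw [integral_smul_measure, integral_dirac, ENNReal.toReal_ofReal
    (mul_nonneg (traceProb₁_nonneg ..) (traceProb₂_nonneg ..)), smul_eq_mul]

/-- Conditional expectation given the first component under `μ ⊗ₘ κ`. -/
lemma condExp_compProd_fst {α β : Type*} [MeasurableSpace α] [MeasurableSpace β] (μ : Measure α)
    [IsProbabilityMeasure μ] (κ : Kernel α β) [IsMarkovKernel κ] {f : α × β → ℝ}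
    (hf : Measurable f) {C : ℝ} (hC : ∀ x, |f x| ≤ C) :
    (μ ⊗ₘ κ)[f | MeasurableSpace.comap Prod.fst inferInstance] =ᵐ[μ ⊗ₘ κ]
      fun ω => ∫ y, f (ω.1, y) ∂(κ ω.1) := by
  have hm : Measurable fun a => ∫ y, f (a, y) ∂(κ a) :=
    (hf.stronglyMeasurable.integral_kernel_prod_right' (κ := κ)).measurable
  have hb : ∀ a, |∫ y, f (a, y) ∂(κ a)| ≤ C := fun a => abs_integral_le_of_bound fun y => hC _
  have hint : Integrable f (μ ⊗ₘ κ) := integrable_of_measurable_of_bound hf hC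
  have hint' : Integrable (fun ω : α × β => ∫ y, f (ω.1, y) ∂(κ ω.1)) (μ ⊗ₘ κ) :=
    integrable_of_measurable_of_bound (hm.comp measurable_fst) fun ω => hb _
  refine (ae_eq_condExp_of_forall_setIntegral_eq measurable_fst.comap_le hint
    (fun s _ _ => hint'.integrableOn) ?_ ?_).symm
  · rintro _ ⟨t, ht, rfl⟩ -
    have e : (Prod.fst ⁻¹' t : Set (α × β)) = t ×ˢ Set.univ := by ext; simp
    rw [e, Measure.setIntegral_compProd ht MeasurableSet.univ hint'.integrableOn,
      Measure.setIntegral_compProd ht MeasurableSet.univ hint.integrableOn]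
    simp
  · exact ((hm.comp (comap_measurable Prod.fst)).stronglyMeasurable).aestronglyMeasurable

/-! ### The estimator as a function of the particle system -/

/-- An explicit version of `μ_b^N(φ)`, as a function of the particle system. -/
noncomputable def estimator (F : Model X) {N : ℕ → ℕ} {n : ℕ} (b : Fin (n + 1) → Bool)
    (φ : X × X → ℝ) (s : System X N n) : ℝ :=
  ∑ i, ∑ j, pairWeight F b s i j * φ (s.2 (Fin.last n) i, s.2 (Fin.last n) j)

/-- `coincProb` uses a product of indicators over times because that form splits off the last time;
here it is matched with the indicator of the set. -/
lemma coincProb_eq_indicator (F : Model X) {N : ℕ → ℕ} {n : ℕ} (b : Fin (n + 1) → Bool)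
    (s : System X N n) (k k' : Lineage N n) (h : Lineage N n × Lineage N n → ℝ) :
    coincProb F b s k k' * h (k, k') =
      traceProb₁ s k * traceProb₂ F s k k' * (coincidence b).indicator h (k, k') := by
  unfold coincProb
  by_cases hk : (k, k') ∈ (coincidence b : Set (Lineage N n × Lineage N n))
  · rw [Set.indicator_of_mem hk, Finset.prod_eq_one fun p _ => if_pos (hk p), one_mul]
  · rw [Set.indicator_of_notMem hk]
    obtain ⟨p, hp⟩ : ∃ p, ¬ (k p = k' p ↔ b p = true) := by
      simpa [coincidence] using hk
    rw [Finset.prod_eq_zero (Finset.mem_univ p) (if_neg hp)]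
    simp

lemma measurable_apply_last {N : ℕ → ℕ} {n : ℕ} (i : Fin (N n)) :
    Measurable fun s : System X N n => s.2 (Fin.last n) i :=
  (measurable_pi_apply (X := fun _ : Fin (N n) => X) i).comp
    ((measurable_pi_apply (Fin.last n)).comp measurable_snd)

/-- The conditional expectation is the integral against `traceKernel`, a finite sum over pairs of
lineages. After this the tracing variables play no role. -/
lemma muN_ae_eq (F : Model X) (N : ℕ → ℕ) (n : ℕ) (hN : ∀ p ≤ n, 0 < N p)
    (b : Fin (n + 1) → Bool) {φ : X × X → ℝ} (hφ : Measurable φ) {C : ℝ} (hC : ∀ x, |φ x| ≤ C) :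
    muN F N n b φ =ᵐ[jointLaw F N n] fun ω => estimator F b φ ω.1 := by
  have := isProbabilityMeasure_particleLaw F N n fun p hp => hN p hp.le
  have := isMarkovKernel_traceKernel F N n hN
  have hm : Measurable fun ω : Sample X N n => (coincidence b).indicator
      (fun k => φ (ω.1.2 (Fin.last n) (k.1 (Fin.last n)),
        ω.1.2 (Fin.last n) (k.2 (Fin.last n)))) ω.2 := by
    refine measurable_from_prod_countable_left fun k => ?_
    by_cases hk : k ∈ (coincidence b : Set (Lineage N n × Lineage N n))
    · simp only [Set.indicator_of_mem hk]
      exact hφ.comp ((measurable_apply_last _).prodMk (measurable_apply_last _))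
    · simp only [Set.indicator_of_notMem hk]
      exact measurable_const
  have hb : ∀ ω : Sample X N n, |(coincidence b).indicator
      (fun k => φ (ω.1.2 (Fin.last n) (k.1 (Fin.last n)),
        ω.1.2 (Fin.last n) (k.2 (Fin.last n)))) ω.2| ≤ C := fun ω => by
    by_cases hk : ω.2 ∈ (coincidence b : Set (Lineage N n × Lineage N n))
    · rw [Set.indicator_of_mem hk]
      exact hC _
    · rw [Set.indicator_of_notMem hk, abs_zero]
      -- Only `0 ≤ C` is at stake, and it requires a point of `X`.
      obtain ⟨x⟩ := nonempty_of_isProbabilityMeasure F.M₀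
      exact (abs_nonneg _).trans (hC (x, x))
  filter_upwards [condExp_compProd_fst (particleLaw F N n) (traceKernel F N n) hm hb] with ω hω
  unfold muN jointLaw
  rw [hω, integral_traceKernel]
  unfold estimator
  rw [sum_pairWeight_mul F b ω.1 (fun i j =>
    φ (ω.1.2 (Fin.last n) i, ω.1.2 (Fin.last n) j))]
  unfold bitFactor
  congr 1
  refine Finset.sum_congr rfl fun k _ => Finset.sum_congr rfl fun k' _ => ?_
  exact (coincProb_eq_indicator F b ω.1 k k' (fun k =>
    φ (ω.1.2 (Fin.last n) (k.1 (Fin.last n)), ω.1.2 (Fin.last n) (k.2 (Fin.last n))))).symm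

lemma integral_jointLaw_fst (F : Model X) (N : ℕ → ℕ) (n : ℕ) (hN : ∀ p ≤ n, 0 < N p)
    {h : System X N n → ℝ} (hh : Measurable h) :
    ∫ ω, h ω.1 ∂(jointLaw F N n) = ∫ s, h s ∂(particleLaw F N n) := by
  have := isProbabilityMeasure_particleLaw F N n fun p hp => hN p hp.le
  have := isMarkovKernel_traceKernel F N n hN
  have e : (jointLaw F N n).map Prod.fst = particleLaw F N n := Measure.fst_compProd _ _
  conv_rhs => rw [← e]
  rw [integral_map measurable_fst.aemeasurable hh.aestronglyMeasurable]

/-! ### Positivity, bounds and measurability of the weights. -/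

lemma coincProb_nonneg (F : Model X) {N : ℕ → ℕ} {n : ℕ} (b : Fin (n + 1) → Bool)
    (s : System X N n) (k k' : Lineage N n) : 0 ≤ coincProb F b s k k' :=
  mul_nonneg (Finset.prod_nonneg fun p _ => by split_ifs <;> simp)
    (mul_nonneg (traceProb₁_nonneg ..) (traceProb₂_nonneg ..))

lemma coincProb_le (F : Model X) {N : ℕ → ℕ} {n : ℕ} (b : Fin (n + 1) → Bool)
    (s : System X N n) (k k' : Lineage N n) :
    coincProb F b s k k' ≤ traceProb₁ s k * traceProb₂ F s k k' :=
  mul_le_of_le_one_left (mul_nonneg (traceProb₁_nonneg ..) (traceProb₂_nonneg ..))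
    (Finset.prod_le_one (fun p _ => by split_ifs <;> simp) fun p _ => by split_ifs <;> simp)

lemma bitFactor_nonneg {N : ℕ → ℕ} {n : ℕ} (hN : ∀ p ≤ n, 2 ≤ N p) (b : Fin (n + 1) → Bool) :
    0 ≤ bitFactor N b := by
  refine Finset.prod_nonneg fun p _ => ?_
  have : (2 : ℝ) ≤ N p := by exact_mod_cast hN p (by omega)
  split_ifs
  · positivity
  · exact div_nonneg (by positivity) (by linarith)

lemma pairWeight_nonneg (F : Model X) {N : ℕ → ℕ} {n : ℕ} (hN : ∀ p ≤ n, 2 ≤ N p)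
    (b : Fin (n + 1) → Bool) (s : System X N n) (i j : Fin (N n)) :
    0 ≤ pairWeight F b s i j := by
  refine mul_nonneg (mul_nonneg (bitFactor_nonneg hN b) (sq_nonneg _)) ?_
  refine Finset.sum_nonneg fun k _ => Finset.sum_nonneg fun k' _ => ?_
  split_ifs
  · exact coincProb_nonneg ..
  · exact le_rfl
  · exact le_rfl

lemma exists_gammaN_one_le (F : Model X) {N : ℕ → ℕ} {n : ℕ} (hN : 0 < N n) :
    ∃ C : ℝ, ∀ s : System X N n, gammaN F s (fun _ => 1) ^ 2 ≤ C := by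
  choose B hB using F.G_bdd
  refine ⟨(∏ p : Fin n, (N p : ℝ)⁻¹ * (N p * |B p|)) ^ 2, fun s => ?_⟩
  rw [gammaN_one F hN]
  refine pow_le_pow_left₀ (Finset.prod_nonneg fun p _ => ?_) (Finset.prod_le_prod ?_ ?_) 2
  · exact mul_nonneg (by positivity) (Finset.sum_nonneg fun i _ => (F.G_pos _ _).le)
  · exact fun p _ => mul_nonneg (by positivity) (Finset.sum_nonneg fun i _ => (F.G_pos _ _).le)
  · intro p _
    refine mul_le_mul_of_nonneg_left ?_ (by positivity)
    refine (Finset.sum_le_card_nsmul _ _ |B p| fun i _ => (hB p _).trans (le_abs_self _)).trans ?_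
    simp

/-- The bound depends on `N` and serves integrability only; the factor 1 is the total mass of the
tracing probabilities. -/
lemma exists_pairWeight_le (F : Model X) {N : ℕ → ℕ} {n : ℕ} (hN : ∀ p ≤ n, 2 ≤ N p)
    (b : Fin (n + 1) → Bool) :
    ∃ C : ℝ, ∀ (s : System X N n) (i j : Fin (N n)), |pairWeight F b s i j| ≤ C := by
  have hN0 : ∀ p ≤ n, 0 < N p := fun p hp => lt_of_lt_of_le two_pos (hN p hp)
  obtain ⟨C, hC⟩ := exists_gammaN_one_le F (hN0 n le_rfl)
  refine ⟨bitFactor N b * C * 1, fun s i j => ?_⟩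
  rw [abs_of_nonneg (pairWeight_nonneg F hN b s i j)]
  have hb := bitFactor_nonneg hN b
  have hC0 : 0 ≤ C := (sq_nonneg _).trans (hC s)
  refine mul_le_mul (mul_le_mul_of_nonneg_left (hC s) hb) ?_ ?_ (mul_nonneg hb hC0)
  · calc _ ≤ ∑ k : Lineage N n, ∑ k', traceProb₁ s k * traceProb₂ F s k k' := by
          refine Finset.sum_le_sum fun k _ => Finset.sum_le_sum fun k' _ => ?_
          have h := mul_nonneg (traceProb₁_nonneg s k) (traceProb₂_nonneg F s k k')
          split_ifs
          · exact coincProb_le ..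
          · exact h
          · exact h
      _ = 1 := by
          simp_rw [← Finset.mul_sum, sum_traceProb₂ F hN0, mul_one, sum_traceProb₁ (hN0 n le_rfl)]
  · refine Finset.sum_nonneg fun k _ => Finset.sum_nonneg fun k' _ => ?_
    split_ifs
    · exact coincProb_nonneg ..
    · exact le_rfl
    · exact le_rfl

lemma measurable_pairWeight (F : Model X) {N : ℕ → ℕ} {n : ℕ}
    (b : Fin (n + 1) → Bool) (i j : Fin (N n)) :
    Measurable fun s : System X N n => pairWeight F b s i j := by
  have hη : ∀ (p : Fin (n + 1)) {f : X → ℝ}, Measurable f →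
      Measurable fun s : System X N n => etaN s p f := fun p f hf =>
    (Finset.measurable_sum _ fun i _ => hf.comp ((measurable_pi_apply i).comp
      ((measurable_pi_apply p).comp measurable_snd))).const_mul _
  have hγ : Measurable fun s : System X N n => gammaN F s (fun _ => 1) := by
    unfold gammaN
    exact (Finset.measurable_prod _ fun (p : Fin n) _ =>
      hη p.castSucc (F.measurable_G p)).mul (hη _ measurable_const)
  refine ((hγ.pow_const 2).const_mul _).mul
    (Finset.measurable_sum _ fun k _ => Finset.measurable_sum _ fun k' _ => ?_)
  split_ifs
  · exact ((measurable_traceProb₁ k).mul (measurable_traceProb₂ F k k')).const_mul _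
  · exact measurable_const
  · exact measurable_const

lemma measurable_estimator (F : Model X) {N : ℕ → ℕ} {n : ℕ} (b : Fin (n + 1) → Bool)
    {φ : X × X → ℝ} (hφ : Measurable φ) :
    Measurable fun s : System X N n => estimator F b φ s :=
  Finset.measurable_sum _ fun i _ => Finset.measurable_sum _ fun j _ =>
    (measurable_pairWeight F b i j).mul
      (hφ.comp ((measurable_apply_last i).prodMk (measurable_apply_last j)))

lemma abs_sum_sum_le {m : ℕ} {h : Fin m → Fin m → ℝ} {C : ℝ} (hC : ∀ i j, |h i j| ≤ C) :
    |∑ i, ∑ j, h i j| ≤ m * (m * C) := by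
  refine (Finset.abs_sum_le_sum_abs _ _).trans
    ((Finset.sum_le_card_nsmul _ _ (m * C) fun i _ => ?_).trans (by simp))
  exact (Finset.abs_sum_le_sum_abs _ _).trans
    ((Finset.sum_le_card_nsmul _ _ C fun j _ => hC i j).trans (by simp))

lemma exists_estimator_le (F : Model X) {N : ℕ → ℕ} {n : ℕ} (hN : ∀ p ≤ n, 2 ≤ N p)
    (b : Fin (n + 1) → Bool) {φ : X × X → ℝ} {B : ℝ} (hφ : ∀ x, |φ x| ≤ B) :
    ∃ C : ℝ, ∀ s : System X N n, |estimator F b φ s| ≤ C := by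
  obtain ⟨C, hC⟩ := exists_pairWeight_le F hN b
  refine ⟨N n * (N n * (C * B)), fun s => abs_sum_sum_le fun i j => ?_⟩
  rw [abs_mul]
  exact mul_le_mul (hC s i j) (hφ _) (abs_nonneg _) ((abs_nonneg _).trans (hC s i j))

/-! ### One step of the particle system -/

lemma exists_abs_le_of_finite {α : Type*} [Finite α] (f : α → ℝ) : ∃ C, ∀ a, |f a| ≤ C := by
  obtain ⟨C, hC⟩ := (Set.finite_range fun a => |f a|).bddAbove
  exact ⟨C, fun a => hC ⟨a, rfl⟩⟩

lemma integral_offspringKernel_fst (F : Model X) (p : ℕ) {k : ℕ} (z : Fin k → X) (f : Fin k → ℝ) :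
    ∫ y, f y.1 ∂(offspringKernel F p k z) = ∑ j, catProb F p z j * f j := by
  obtain ⟨C, hC⟩ := exists_abs_le_of_finite f
  rw [integral_offspringKernel F p z (f := fun y => f y.1)
    ((measurable_of_countable f).comp measurable_fst) fun y => hC _]
  simp

/-- The operator `φ ↦ (G_p ⊗ G_p) · P φ`, with `P` one step of the pair chain. -/
noncomputable def transfer (F : Model X) (p : ℕ) (bit : Bool) (φ : X × X → ℝ) (x : X × X) : ℝ :=
  F.G p x.1 * F.G p x.2 * ∫ y, φ y ∂(pairKernel F p bit x)

instance (F : Model X) (p : ℕ) (bit : Bool) : IsMarkovKernel (pairKernel F p bit) := by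
  unfold pairKernel
  cases bit
  · simp only [Bool.false_eq_true, if_false]
    infer_instance
  · simp only [if_true]
    exact Kernel.IsMarkovKernel.map _ (measurable_id.prodMk measurable_id)

lemma integral_pairKernel_true (F : Model X) (p : ℕ) {φ : X × X → ℝ} (hφ : Measurable φ)
    (x : X × X) : ∫ y, φ y ∂(pairKernel F p true x) = ∫ y, φ (y, y) ∂(F.M p x.1) := by
  have hd : Measurable fun y : X => (y, y) := measurable_id.prodMk measurable_id
  simp only [pairKernel, if_true]
  rw [Kernel.map_apply _ hd, integral_map hd.aemeasurable hφ.aestronglyMeasurable,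
    Kernel.comap_apply]

lemma integral_pairKernel_false (F : Model X) (p : ℕ) {φ : X × X → ℝ} (hφ : Measurable φ)
    {B : ℝ} (hB : ∀ x, |φ x| ≤ B) (x : X × X) :
    ∫ y, φ y ∂(pairKernel F p false x) = ∫ y, ∫ y', φ (y, y') ∂(F.M p x.2) ∂(F.M p x.1) := by
  simp only [pairKernel, Bool.false_eq_true, if_false]
  rw [Kernel.parallelComp_apply, integral_prod _ (integrable_of_measurable_of_bound hφ hB)]

lemma measurable_transfer (F : Model X) (p : ℕ) (bit : Bool) {φ : X × X → ℝ}
    (hφ : Measurable φ) : Measurable (transfer F p bit φ) :=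
  (((F.measurable_G p).comp measurable_fst).mul ((F.measurable_G p).comp measurable_snd)).mul
    (hφ.stronglyMeasurable.integral_kernel (κ := pairKernel F p bit)).measurable

lemma abs_transfer_le (F : Model X) (p : ℕ) (bit : Bool) {φ : X × X → ℝ} {B g : ℝ}
    (hB : ∀ x, |φ x| ≤ B) (hg : ∀ x, F.G p x ≤ g) (x : X × X) :
    |transfer F p bit φ x| ≤ g * g * B := by
  unfold transfer
  have h0 := F.G_pos p x.1
  have h1 := F.G_pos p x.2
  rw [abs_mul, abs_of_pos (mul_pos h0 h1)]
  refine mul_le_mul (mul_le_mul (hg _) (hg _) h1.le (h0.le.trans (hg _)))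
    (abs_integral_le_of_bound hB) (abs_nonneg _) ?_
  exact mul_nonneg (h0.le.trans (hg _)) (h0.le.trans (hg _))

/-- The estimator at time `p + 1` as a function of the ancestors and particles at that time. -/
noncomputable def stepSum (F : Model X) (p : ℕ) {k m : ℕ} (bit : Bool) (z : Fin k → X)
    (w : Fin k → Fin k → ℝ) (φ : X × X → ℝ) (y : Fin m → Fin k × X) : ℝ :=
  ∑ i, ∑ j, stepWeight F p bit z w (fun i => (y i).1) i j * φ ((y i).2, (y j).2)

lemma measurable_fst_apply {k m : ℕ} :
    Measurable fun (y : Fin m → Fin k × X) (i : Fin m) => (y i).1 :=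
  measurable_pi_iff.2 fun i => measurable_fst.comp (measurable_pi_apply i)

lemma measurable_comp_ancestors {k m : ℕ} (f : (Fin m → Fin k) → ℝ) :
    Measurable fun y : Fin m → Fin k × X => f (fun i => (y i).1) :=
  (measurable_of_countable f).comp measurable_fst_apply

lemma measurable_apply_pair {k m : ℕ} {φ : X × X → ℝ} (hφ : Measurable φ) (i j : Fin m) :
    Measurable fun y : Fin m → Fin k × X => φ ((y i).2, (y j).2) :=
  hφ.comp ((measurable_snd.comp (measurable_pi_apply i)).prodMk
    (measurable_snd.comp (measurable_pi_apply j)))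

/-- With `z` and `w` fixed the arguments range over a finite set. The absolute value makes the bound
nonnegative even if that set is empty. -/
lemma exists_stepWeight_le (F : Model X) (p : ℕ) {k m : ℕ} (bit : Bool) (z : Fin k → X)
    (w : Fin k → Fin k → ℝ) :
    ∃ C, 0 ≤ C ∧ ∀ (a : Fin m → Fin k) (i j : Fin m), |stepWeight F p bit z w a i j| ≤ C := by
  obtain ⟨C, hC⟩ := exists_abs_le_of_finite fun q : (Fin m → Fin k) × Fin m × Fin m =>
    stepWeight F p bit z w q.1 q.2.1 q.2.2
  exact ⟨|C|, abs_nonneg _, fun a i j => (hC (a, i, j)).trans (le_abs_self _)⟩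

lemma stepWeight_nonneg (F : Model X) (p : ℕ) {k m : ℕ} (hm : 2 ≤ m) (bit : Bool) (z : Fin k → X)
    {w : Fin k → Fin k → ℝ} (hw : ∀ i j, 0 ≤ w i j) (a : Fin m → Fin k) (i j : Fin m) :
    0 ≤ stepWeight F p bit z w a i j := by
  have hS : 0 ≤ ∑ r, F.G p (z r) := Finset.sum_nonneg fun r _ => (F.G_pos p _).le
  have hm' : (0 : ℝ) ≤ (m : ℝ) - 1 := by
    have : (2 : ℝ) ≤ m := by exact_mod_cast hm
    linarith
  unfold stepWeight
  split_ifs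
  · exact mul_nonneg (div_nonneg hS (by positivity))
      (Finset.sum_nonneg fun l _ => mul_nonneg (hw _ _) (F.G_pos p _).le)
  · exact le_rfl
  · exact le_rfl
  · exact mul_nonneg (by positivity) (hw _ _)

lemma sum_sum_ite_ne (m : ℕ) (c : ℝ) :
    (∑ i : Fin m, ∑ j : Fin m, if i = j then 0 else c) = m * (m - 1) * c := by
  have : ∀ i j : Fin m, (if i = j then 0 else c) = c - if i = j then c else 0 := fun i j => by
    split_ifs <;> simp
  simp_rw [this, Finset.sum_sub_distrib]
  simp
  ring

/-- The one-step mean behind the lack of bias. With bit 0 there are `m * (m - 1)` off-diagonal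
pairs, each formed by two independent draws whose normalisers cancel `S ^ 2`. With bit 1 there are
`m` diagonal terms, one draw cancels `S`, and the second potential already sits in the weight. -/
lemma integral_stepSum (F : Model X) (p : ℕ) {k m : ℕ} (hk : 0 < k) (hm : 2 ≤ m) (bit : Bool)
    (z : Fin k → X) (w : Fin k → Fin k → ℝ) {φ : X × X → ℝ} (hφ : Measurable φ) {B : ℝ}
    (hB : ∀ x, |φ x| ≤ B) :
    ∫ y, stepSum F p bit z w φ y ∂(Measure.pi fun _ : Fin m => offspringKernel F p k z) =
      ∑ r, ∑ l, w r l * transfer F p bit φ (z r, z l) := by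
  have := isMarkovKernel_offspringKernel F p hk
  obtain ⟨C, hC0, hC⟩ := exists_stepWeight_le (m := m) F p bit z w
  obtain ⟨W, hW⟩ := exists_abs_le_of_finite fun q : Fin k × Fin k => w q.1 q.2
  have hint : ∀ i j, Integrable (fun y : Fin m → Fin k × X =>
      stepWeight F p bit z w (fun i => (y i).1) i j * φ ((y i).2, (y j).2))
      (Measure.pi fun _ : Fin m => offspringKernel F p k z) := fun i j =>
    integrable_of_measurable_of_bound ((measurable_comp_ancestors
      fun a => stepWeight F p bit z w a i j).mul (measurable_apply_pair hφ i j)) (C := C * B)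
      fun y => by
        rw [abs_mul]
        exact mul_le_mul (hC _ _ _) (hB _) (abs_nonneg _) hC0
  have hm0 : (m : ℝ) ≠ 0 := by positivity
  have hm1 : (m : ℝ) - 1 ≠ 0 := by
    have : (2 : ℝ) ≤ m := by exact_mod_cast hm
    linarith
  have hS := (sum_G_pos F p hk z).ne'
  unfold stepSum
  rw [integral_finsetSum _ fun i _ => integrable_finsetSum _ fun j _ => hint i j]
  simp_rw [integral_finsetSum _ fun j _ => hint _ j]
  cases bit
  · have hv : ∀ i j : Fin m, ∫ y : Fin m → Fin k × X,
        stepWeight F p false z w (fun i => (y i).1) i j * φ ((y i).2, (y j).2)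
        ∂(Measure.pi fun _ : Fin m => offspringKernel F p k z) =
        if i = j then 0 else (m * (m - 1) : ℝ)⁻¹ *
          ∑ r, ∑ l, w r l * transfer F p false φ (z r, z l) := by
      intro i j
      unfold stepWeight
      by_cases hij : i = j
      · simp [hij]
      · simp only [Bool.false_eq_true, if_false, if_neg hij]
        have hmeas : Measurable fun q : (Fin k × X) × (Fin k × X) =>
            w q.1.1 q.2.1 * φ (q.1.2, q.2.2) :=
          ((measurable_of_countable fun q : Fin k × Fin k => w q.1 q.2).comp
            ((measurable_fst.comp measurable_fst).prodMk
              (measurable_fst.comp measurable_snd))).mul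
            (hφ.comp ((measurable_snd.comp measurable_fst).prodMk
              (measurable_snd.comp measurable_snd)))
        have hbd : ∀ q : (Fin k × X) × (Fin k × X),
            |w q.1.1 q.2.1 * φ (q.1.2, q.2.2)| ≤ W * B := fun q => by
          rw [abs_mul]
          exact mul_le_mul (hW (q.1.1, q.2.1)) (hB _) (abs_nonneg _)
            ((abs_nonneg _).trans (hW (q.1.1, q.2.1)))
        simp_rw [mul_assoc]
        rw [integral_const_mul, integral_pi_eval_two (offspringKernel F p k z) hij hmeas hbd,
          integral_offspringKernel F p z (f := fun a => ∫ b, w a.1 b.1 * φ (a.2, b.2)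
            ∂(offspringKernel F p k z))
            (hmeas.stronglyMeasurable.integral_prod_right').measurable
            (fun a => abs_integral_le_of_bound fun b => hbd (a, b))]
        simp only [Finset.mul_sum]
        refine Finset.sum_congr rfl fun r _ => ?_
        have h1 : ∀ x, ∫ b, w r b.1 * φ (x, b.2) ∂(offspringKernel F p k z) =
            ∑ l, catProb F p z l * (w r l * ∫ x', φ (x, x') ∂(F.M p (z l))) := by
          intro x
          rw [integral_offspringKernel F p z (f := fun b => w r b.1 * φ (x, b.2))
            (hmeas.comp (measurable_const.prodMk measurable_id : Measurable fun b => ((r, x), b)))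
            fun b => hbd ((r, x), b)]
          simp_rw [integral_const_mul]
        simp_rw [h1]
        rw [integral_finsetSum _ fun l _ => ?_]
        · simp only [Finset.mul_sum]
          refine Finset.sum_congr rfl fun l _ => ?_
          unfold transfer catProb
          rw [integral_const_mul, integral_const_mul, integral_pairKernel_false F p hφ hB]
          field_simp
        · refine Integrable.const_mul (Integrable.const_mul ?_ _) _
          exact integrable_of_measurable_of_bound
            (hφ.stronglyMeasurable.integral_prod_right').measurable
            fun x => abs_integral_le_of_bound fun b => hB _
    simp_rw [hv]
    rw [sum_sum_ite_ne]
    field_simp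
  · have hv : ∀ i j : Fin m, ∫ y : Fin m → Fin k × X,
        stepWeight F p true z w (fun i => (y i).1) i j * φ ((y i).2, (y j).2)
        ∂(Measure.pi fun _ : Fin m => offspringKernel F p k z) =
        if i = j then (m : ℝ)⁻¹ * ∑ r, ∑ l, w r l * transfer F p true φ (z r, z l) else 0 := by
      intro i j
      unfold stepWeight
      by_cases hij : i = j
      · subst hij
        simp only [if_true]
        obtain ⟨V, hV⟩ := exists_abs_le_of_finite fun r => ∑ l, w r l * F.G p (z l)
        have hmeas : Measurable fun q : Fin k × X =>
            (∑ l, w q.1 l * F.G p (z l)) * φ (q.2, q.2) :=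
          ((measurable_of_countable fun r => ∑ l, w r l * F.G p (z l)).comp measurable_fst).mul
            (hφ.comp (measurable_snd.prodMk measurable_snd))
        have hbd : ∀ q : Fin k × X,
            |(∑ l, w q.1 l * F.G p (z l)) * φ (q.2, q.2)| ≤ V * B := fun q => by
          rw [abs_mul]
          exact mul_le_mul (hV q.1) (hB _) (abs_nonneg _) ((abs_nonneg _).trans (hV q.1))
        simp_rw [mul_assoc]
        rw [integral_const_mul, integral_pi_eval (offspringKernel F p k z) i hmeas,
          integral_offspringKernel F p z hmeas hbd]
        simp only [Finset.mul_sum]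
        refine Finset.sum_congr rfl fun r _ => ?_
        simp_rw [integral_const_mul, Finset.sum_mul, Finset.mul_sum]
        refine Finset.sum_congr rfl fun l _ => ?_
        unfold transfer catProb
        rw [integral_pairKernel_true F p hφ]
        field_simp
      · simp [hij]
    simp_rw [hv]
    simp
    field_simp

/-! ### Second moments of the row and column sums of the weights -/

/-- The sum of the squared row sums. -/
noncomputable def rowSq {m : ℕ} (w : Fin m → Fin m → ℝ) : ℝ := ∑ i, (∑ j, w i j) ^ 2

/-- The sum of the squared row sums and of the squared column sums. -/
noncomputable def marginSq {m : ℕ} (w : Fin m → Fin m → ℝ) : ℝ :=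
  rowSq w + rowSq (fun i j => w j i)

lemma rowSq_nonneg {m : ℕ} (w : Fin m → Fin m → ℝ) : 0 ≤ rowSq w :=
  Finset.sum_nonneg fun _ _ => sq_nonneg _

lemma sum_sq_le_rowSq {m : ℕ} {w : Fin m → Fin m → ℝ} (hw : ∀ i j, 0 ≤ w i j) :
    ∑ i, ∑ j, w i j ^ 2 ≤ rowSq w :=
  Finset.sum_le_sum fun i _ => Finset.sum_sq_le_sq_sum_of_nonneg fun j _ => hw i j

lemma sum_G_le (F : Model X) (p : ℕ) {k : ℕ} (z : Fin k → X) {g : ℝ} (hg : ∀ x, F.G p x ≤ g) :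
    ∑ r, F.G p (z r) ≤ k * g :=
  (Finset.sum_le_card_nsmul _ _ g fun i _ => hg _).trans (by simp)

lemma sum_G_mul_sq_le (F : Model X) (p : ℕ) {k : ℕ} (z : Fin k → X) {g : ℝ}
    (hg : ∀ x, F.G p x ≤ g) (hg0 : 0 ≤ g) {w : Fin k → Fin k → ℝ} (hw : ∀ i j, 0 ≤ w i j) :
    ∑ r, F.G p (z r) * (∑ l, w r l * F.G p (z l)) ^ 2 ≤ g ^ 3 * rowSq w := by
  unfold rowSq
  rw [Finset.mul_sum]
  refine Finset.sum_le_sum fun r _ => ?_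
  have h1 : ∑ l, w r l * F.G p (z l) ≤ g * ∑ l, w r l := by
    rw [Finset.mul_sum]
    exact Finset.sum_le_sum fun l _ => by
      rw [mul_comm]
      exact mul_le_mul_of_nonneg_right (hg _) (hw _ _)
  have h0 : 0 ≤ ∑ l, w r l * F.G p (z l) :=
    Finset.sum_nonneg fun l _ => mul_nonneg (hw _ _) (F.G_pos p _).le
  calc _ ≤ g * (g * ∑ l, w r l) ^ 2 :=
        mul_le_mul (hg _) (pow_le_pow_left₀ h0 h1 2) (sq_nonneg _) hg0
    _ = _ := by ring

/-- Each row of the new weights has one entry, a function of one ancestor. The `m` equal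
expectations and the factor `m` cancel `1 / m ^ 2`, leaving `S ≤ k * g` times a sum bounded by `g ^
3 * rowSq w`. The factors `m` and `k` make this a bound on the growth of (particle number) ×
`rowSq`. -/
lemma integral_rowSq_stepWeight_true (F : Model X) (p : ℕ) {k m : ℕ} (hk : 0 < k) (hm : 2 ≤ m)
    (z : Fin k → X) {g : ℝ} (hg : ∀ x, F.G p x ≤ g) (hg0 : 0 ≤ g) {w : Fin k → Fin k → ℝ}
    (hw : ∀ i j, 0 ≤ w i j) :
    m * ∫ y, rowSq (stepWeight F p true z w (fun i => (y i).1))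
      ∂(Measure.pi fun _ : Fin m => offspringKernel F p k z) ≤ g ^ 4 * k * rowSq w := by
  have := isMarkovKernel_offspringKernel F p hk
  have hS := sum_G_pos F p hk z
  have hm0 : (m : ℝ) ≠ 0 := by positivity
  set S := ∑ r, F.G p (z r) with hSdef
  set q : Fin k → ℝ := fun r => (S / m * ∑ l, w r l * F.G p (z l)) ^ 2 with hq
  have h1 : ∀ y : Fin m → Fin k × X, rowSq (stepWeight F p true z w (fun i => (y i).1)) =
      ∑ i, q (y i).1 := fun y => by
    unfold rowSq stepWeight
    refine Finset.sum_congr rfl fun i _ => ?_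
    simp [hq, hSdef]
  obtain ⟨C, hC⟩ := exists_abs_le_of_finite q
  have hqm : Measurable fun y : Fin k × X => q y.1 :=
    (measurable_of_countable q).comp measurable_fst
  simp_rw [h1]
  have hint : ∀ i : Fin m, Integrable (fun y : Fin m → Fin k × X => q (y i).1)
      (Measure.pi fun _ : Fin m => offspringKernel F p k z) := fun i =>
    integrable_of_measurable_of_bound (hqm.comp (measurable_pi_apply i)) fun y => hC _
  rw [integral_finsetSum _ fun i _ => hint i]
  simp_rw [fun i : Fin m => integral_pi_eval (offspringKernel F p k z) i hqm,
    integral_offspringKernel_fst F p z q]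
  calc _ = S * ∑ r, F.G p (z r) * (∑ l, w r l * F.G p (z l)) ^ 2 := by
        simp only [Finset.sum_const, Finset.card_univ, Fintype.card_fin, nsmul_eq_mul]
        simp only [hq, catProb, ← hSdef, Finset.mul_sum]
        refine Finset.sum_congr rfl fun r _ => ?_
        have := hS.ne'
        simp only [← Finset.mul_sum]
        field_simp
    _ ≤ (k * g) * (g ^ 3 * rowSq w) :=
        mul_le_mul (sum_G_le F p z hg) (sum_G_mul_sq_le F p z hg hg0 hw)
          (Finset.sum_nonneg fun r _ => mul_nonneg (F.G_pos p _).le (sq_nonneg _)) (by positivity)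
    _ = _ := by ring

lemma integral_rowSq_stepWeight_false (F : Model X) (p : ℕ) {k m : ℕ} (hk : 0 < k) (hm : 2 ≤ m)
    (z : Fin k → X) {g : ℝ} (hg : ∀ x, F.G p x ≤ g) (hg0 : 0 ≤ g) {ρ : ℝ} (hρ : k ≤ ρ * (m - 1))
    {w : Fin k → Fin k → ℝ} (hw : ∀ i j, 0 ≤ w i j) :
    m * ∫ y, rowSq (stepWeight F p false z w (fun i => (y i).1))
      ∂(Measure.pi fun _ : Fin m => offspringKernel F p k z) ≤
      g ^ 4 * (1 + ρ) * k * rowSq w := by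
  have := isMarkovKernel_offspringKernel F p hk
  have hS := sum_G_pos F p hk z
  have hS' := hS.ne'
  have hm0 : (m : ℝ) ≠ 0 := by positivity
  have hm2 : (2 : ℝ) ≤ m := by exact_mod_cast hm
  have hm1 : 0 < (m : ℝ) - 1 := by linarith
  have hm1' := hm1.ne'
  set S := ∑ r, F.G p (z r) with hSdef
  set κ : ℝ := S ^ 2 / (m * (m - 1)) with hκ
  set ν := offspringKernel F p k z with hν
  -- The square of a row sum expands over `(j, j')`: `D₁` is the mean for `j = j'` and `D₂` the mean
  -- for distinct `j`, `j'`, apart from the factor `κ ^ 2`.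
  set D₁ : ℝ := ∑ r, catProb F p z r * ∑ l, catProb F p z l * w r l ^ 2 with hD₁
  set D₂ : ℝ := ∑ r, catProb F p z r * (∑ l, catProb F p z l * w r l) ^ 2 with hD₂
  have hD₁0 : 0 ≤ D₁ := Finset.sum_nonneg fun r _ => mul_nonneg (catProb_nonneg ..)
    (Finset.sum_nonneg fun l _ => mul_nonneg (catProb_nonneg ..) (sq_nonneg _))
  have hD₂0 : 0 ≤ D₂ := Finset.sum_nonneg fun r _ => mul_nonneg (catProb_nonneg ..) (sq_nonneg _)
  obtain ⟨W, hW⟩ := exists_abs_le_of_finite fun q : Fin k × Fin k => w q.1 q.2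
  obtain ⟨C, hC0, hC⟩ := exists_stepWeight_le (m := m) F p false z w
  have hint : ∀ i j j', Integrable (fun y : Fin m → Fin k × X =>
      stepWeight F p false z w (fun i => (y i).1) i j *
        stepWeight F p false z w (fun i => (y i).1) i j') (Measure.pi fun _ : Fin m => ν) :=
    fun i j j' => integrable_of_measurable_of_bound (measurable_comp_ancestors fun a =>
      stepWeight F p false z w a i j * stepWeight F p false z w a i j') (C := C * C) fun y => by
        rw [abs_mul]
        exact mul_le_mul (hC _ _ _) (hC _ _ _) (abs_nonneg _) hC0
  have hval : ∀ i j j' : Fin m, ∫ y : Fin m → Fin k × X,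
      stepWeight F p false z w (fun i => (y i).1) i j *
        stepWeight F p false z w (fun i => (y i).1) i j' ∂(Measure.pi fun _ : Fin m => ν) ≤
      -- Adding `D₂` also when `j = j'` overcounts, so that each `j` contributes `m - 1` such terms
      -- instead of `m - 2`.
      if i = j then 0 else (if j = j' then κ ^ 2 * D₁ else 0) +
        (if i = j' then 0 else κ ^ 2 * D₂) := by
    intro i j j'
    unfold stepWeight
    simp only [Bool.false_eq_true, if_false, ← hSdef, ← hκ]
    by_cases hij : i = j
    · simp [hij]
    by_cases hij' : i = j'
    · simp only [if_neg hij, if_pos hij', mul_zero, integral_zero]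
      split_ifs
      · positivity
      · simp
    simp only [if_neg hij, if_neg hij']
    have e : ∀ y : Fin m → Fin k × X, κ * w (y i).1 (y j).1 * (κ * w (y i).1 (y j').1) =
        κ ^ 2 * (w (y i).1 (y j).1 * w (y i).1 (y j').1) := fun y => by ring
    simp_rw [e]
    rw [integral_const_mul]
    by_cases hjj : j = j'
    · subst hjj
      have hmeas : Measurable fun q : (Fin k × X) × (Fin k × X) =>
          w q.1.1 q.2.1 * w q.1.1 q.2.1 :=
        (measurable_of_countable fun q : Fin k × Fin k => w q.1 q.2 * w q.1 q.2).comp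
          ((measurable_fst.comp measurable_fst).prodMk (measurable_fst.comp measurable_snd))
      have h2 := integral_pi_eval_two ν hij hmeas (C := W * W) fun q => by
        rw [abs_mul]
        exact mul_le_mul (hW (q.1.1, q.2.1)) (hW (q.1.1, q.2.1)) (abs_nonneg _)
          ((abs_nonneg _).trans (hW (q.1.1, q.2.1)))
      have h3 : ∀ a : Fin k × X, ∫ b, w a.1 b.1 * w a.1 b.1 ∂ν =
          ∑ l, catProb F p z l * w a.1 l ^ 2 := fun a => by
        rw [hν, integral_offspringKernel_fst F p z (fun l => w a.1 l * w a.1 l)]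
        simp_rw [sq]
      simp only [h3] at h2
      rw [h2, hν, integral_offspringKernel_fst F p z
        (fun r => ∑ l, catProb F p z l * w r l ^ 2), ← hD₁]
      simp only [if_true]
      have : 0 ≤ κ ^ 2 * D₂ := by positivity
      linarith
    · have hmeas : Measurable fun q : ((Fin k × X) × (Fin k × X)) × (Fin k × X) =>
          w q.1.1.1 q.1.2.1 * w q.1.1.1 q.2.1 :=
        (measurable_of_countable fun q : (Fin k × Fin k) × Fin k =>
          w q.1.1 q.1.2 * w q.1.1 q.2).comp
          (((measurable_fst.comp (measurable_fst.comp measurable_fst)).prodMk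
            (measurable_fst.comp (measurable_snd.comp measurable_fst))).prodMk
              (measurable_fst.comp measurable_snd))
      have h2 := integral_pi_eval_three ν hij hij' hjj hmeas (C := W * W) fun q => by
        rw [abs_mul]
        exact mul_le_mul (hW (q.1.1.1, q.1.2.1)) (hW (q.1.1.1, q.2.1)) (abs_nonneg _)
          ((abs_nonneg _).trans (hW (q.1.1.1, q.2.1)))
      have h3 : ∀ a b : Fin k × X, ∫ c, w a.1 b.1 * w a.1 c.1 ∂ν =
          w a.1 b.1 * ∑ l, catProb F p z l * w a.1 l := fun a b => by
        rw [integral_const_mul, hν, integral_offspringKernel_fst F p z (fun l => w a.1 l)]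
      have h4 : ∀ a : Fin k × X, ∫ b, w a.1 b.1 * ∑ l, catProb F p z l * w a.1 l ∂ν =
          (∑ l, catProb F p z l * w a.1 l) ^ 2 := fun a => by
        rw [integral_mul_const, hν, integral_offspringKernel_fst F p z (fun l => w a.1 l), sq]
      simp only [h3, h4] at h2
      rw [h2, hν, integral_offspringKernel_fst F p z
        (fun r => (∑ l, catProb F p z l * w r l) ^ 2), ← hD₂]
      simp [hjj]
  have hsum : ∫ y, rowSq (stepWeight F p false z w (fun i => (y i).1))
      ∂(Measure.pi fun _ : Fin m => ν) ≤
      m * (m - 1) * (κ ^ 2 * D₁) + m * (m - 1) * ((m - 1) * (κ ^ 2 * D₂)) := by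
    have e : ∀ y : Fin m → Fin k × X, rowSq (stepWeight F p false z w (fun i => (y i).1)) =
        ∑ i, ∑ j, ∑ j', stepWeight F p false z w (fun i => (y i).1) i j *
          stepWeight F p false z w (fun i => (y i).1) i j' := fun y => by
      unfold rowSq
      refine Finset.sum_congr rfl fun i _ => ?_
      rw [sq, Finset.sum_mul_sum]
    simp_rw [e]
    rw [integral_finsetSum _ fun i _ => integrable_finsetSum _ fun j _ =>
      integrable_finsetSum _ fun j' _ => hint i j j']
    simp_rw [integral_finsetSum _ fun j _ => integrable_finsetSum _ fun j' _ => hint _ j j',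
      integral_finsetSum _ fun j' _ => hint _ _ j']
    refine (Finset.sum_le_sum fun i _ => Finset.sum_le_sum fun j _ =>
      Finset.sum_le_sum fun j' _ => hval i j j').trans (le_of_eq ?_)
    rw [← sum_sum_ite_ne, ← sum_sum_ite_ne, ← Finset.sum_add_distrib]
    refine Finset.sum_congr rfl fun i _ => ?_
    rw [← Finset.sum_add_distrib]
    refine Finset.sum_congr rfl fun j _ => ?_
    by_cases hij : i = j
    · simp [hij]
    · have : ∀ j', (if i = j' then 0 else κ ^ 2 * D₂) =
          κ ^ 2 * D₂ - if i = j' then κ ^ 2 * D₂ else 0 := fun j' => by split_ifs <;> simp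
      simp only [if_neg hij, Finset.sum_add_distrib, this, Finset.sum_sub_distrib]
      simp
      ring
  have hE₁ : S ^ 2 * D₁ ≤ g ^ 2 * rowSq w := by
    have : S ^ 2 * D₁ = ∑ r, ∑ l, F.G p (z r) * F.G p (z l) * w r l ^ 2 := by
      simp only [hD₁, catProb, ← hSdef, Finset.mul_sum]
      refine Finset.sum_congr rfl fun r _ => Finset.sum_congr rfl fun l _ => ?_
      field_simp
    rw [this]
    refine le_trans ?_ (mul_le_mul_of_nonneg_left (sum_sq_le_rowSq hw) (sq_nonneg g))
    simp only [Finset.mul_sum]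
    refine Finset.sum_le_sum fun r _ => Finset.sum_le_sum fun l _ => ?_
    rw [sq g]
    exact mul_le_mul_of_nonneg_right (mul_le_mul (hg _) (hg _) (F.G_pos p _).le hg0) (sq_nonneg _)
  have hE₂ : S ^ 3 * D₂ ≤ g ^ 3 * rowSq w := by
    have : S ^ 3 * D₂ = ∑ r, F.G p (z r) * (∑ l, w r l * F.G p (z l)) ^ 2 := by
      simp only [hD₂, catProb, ← hSdef]
      rw [Finset.mul_sum]
      refine Finset.sum_congr rfl fun r _ => ?_
      have : ∑ l, F.G p (z l) / S * w r l = (∑ l, w r l * F.G p (z l)) / S := by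
        rw [Finset.sum_div]
        exact Finset.sum_congr rfl fun l _ => by ring
      rw [this]
      field_simp
    rw [this]
    exact sum_G_mul_sq_le F p z hg hg0 hw
  have hSk : S ≤ k * g := sum_G_le F p z hg
  have hR := rowSq_nonneg w
  calc _ ≤ m * (m * (m - 1) * (κ ^ 2 * D₁) + m * (m - 1) * ((m - 1) * (κ ^ 2 * D₂))) :=
        mul_le_mul_of_nonneg_left hsum (by positivity)
    _ = S ^ 2 * (S ^ 2 * D₁) / (m - 1) + S * (S ^ 3 * D₂) := by
        rw [hκ]
        field_simp
    _ ≤ (k * g) ^ 2 * (g ^ 2 * rowSq w) / (m - 1) + (k * g) * (g ^ 3 * rowSq w) := by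
        gcongr
    -- The terms `j = j'` carry the ratio `k / (m - 1)` of consecutive particle numbers, which is
    -- what `ρ` bounds.
    _ = g ^ 4 * k * rowSq w * (k / (m - 1)) + g ^ 4 * k * rowSq w := by ring
    _ ≤ g ^ 4 * k * rowSq w * ρ + g ^ 4 * k * rowSq w := by
        gcongr
        rwa [div_le_iff₀ hm1]
    _ = _ := by ring

lemma measurable_rowSq_comp {k m : ℕ} (v : (Fin m → Fin k) → Fin m → Fin m → ℝ) :
    Measurable fun y : Fin m → Fin k × X => rowSq (v fun i => (y i).1) :=
  measurable_comp_ancestors fun a => rowSq (v a)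

/-- With bit 0 the step commutes with transposition, so columns follow from rows. With bit 1 the new
weights are diagonal and both margins are bounded by the old rows, which accounts for the factor 2.
-/
lemma integral_marginSq_stepWeight (F : Model X) (p : ℕ) {k m : ℕ} (hk : 0 < k) (hm : 2 ≤ m)
    (bit : Bool) (z : Fin k → X) {g : ℝ} (hg : ∀ x, F.G p x ≤ g) (hg0 : 0 ≤ g) {ρ : ℝ}
    (hρ : k ≤ ρ * (m - 1)) {w : Fin k → Fin k → ℝ} (hw : ∀ i j, 0 ≤ w i j) :
    m * ∫ y, marginSq (stepWeight F p bit z w (fun i => (y i).1))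
      ∂(Measure.pi fun _ : Fin m => offspringKernel F p k z) ≤
      2 * g ^ 4 * (1 + ρ) * (k * marginSq w) := by
  have := isMarkovKernel_offspringKernel F p hk
  have hm2 : (2 : ℝ) ≤ m := by exact_mod_cast hm
  have hρ0 : 0 ≤ ρ := by
    by_contra! h
    have : ρ * ((m : ℝ) - 1) < 0 := mul_neg_of_neg_of_pos h (by linarith)
    have : (0 : ℝ) ≤ k := by positivity
    linarith
  have hint : ∀ v : (Fin m → Fin k) → Fin m → Fin m → ℝ,
      Integrable (fun y : Fin m → Fin k × X => rowSq (v fun i => (y i).1))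
        (Measure.pi fun _ : Fin m => offspringKernel F p k z) := fun v => by
    obtain ⟨C, hC⟩ := exists_abs_le_of_finite fun a => rowSq (v a)
    exact integrable_of_measurable_of_bound (measurable_rowSq_comp v) fun y => hC _
  have hR := rowSq_nonneg w
  have hR' := rowSq_nonneg fun i j => w j i
  unfold marginSq
  rw [integral_add (hint fun a => stepWeight F p bit z w a)
    (hint fun a i j => stepWeight F p bit z w a j i)]
  cases bit
  · have h1 := integral_rowSq_stepWeight_false F p hk hm z hg hg0 hρ hw
    have h2 := integral_rowSq_stepWeight_false F p hk hm z hg hg0 hρ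
      (w := fun i j => w j i) fun i j => hw j i
    have e : ∀ a : Fin m → Fin k, stepWeight F p false z (fun i j => w j i) a =
        fun i j => stepWeight F p false z w a j i := fun a => by
      ext i j
      simp only [stepWeight, Bool.false_eq_true, if_false, eq_comm (a := i)]
    simp_rw [e] at h2
    have h3 : 0 ≤ g ^ 4 * (1 + ρ) * k * (rowSq w + rowSq fun i j => w j i) := by positivity
    linarith
  · have h1 := integral_rowSq_stepWeight_true F p hk hm z hg hg0 hw
    have e : ∀ a : Fin m → Fin k, (fun i j => stepWeight F p true z w a j i) =
        stepWeight F p true z w a := fun a => by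
      ext i j
      by_cases h : i = j
      · rw [h]
      · simp [stepWeight, h, Ne.symm h]
    simp_rw [e]
    have h3 : 0 ≤ g ^ 4 * ρ * k * rowSq w := by positivity
    have h4 : 0 ≤ g ^ 4 * (1 + ρ) * k * (rowSq fun i j => w j i) := by positivity
    linarith

/-! ### The one-step variance -/

/-- `∑ v i j φ(y i, y j)` minus its part without the index `i` is bounded by the margins at `i`. -/
lemma abs_sum_sub_sum_erase_le {m : ℕ} {v t : Fin m → Fin m → ℝ} {B : ℝ}
    (ht : ∀ i j, |t i j| ≤ B * v i j) (hB : 0 ≤ B) (hv : ∀ i j, 0 ≤ v i j) (i : Fin m) :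
    |∑ a, ∑ c, t a c - ∑ a, ∑ c, if a = i ∨ c = i then 0 else t a c| ≤
      B * (∑ j, v i j + ∑ j, v j i) := by
  rw [← Finset.sum_sub_distrib]
  simp_rw [← Finset.sum_sub_distrib]
  calc _ ≤ ∑ a, ∑ c, ((if a = i then B * v i c else 0) + if c = i then B * v a i else 0) := by
        refine (Finset.abs_sum_le_sum_abs _ _).trans (Finset.sum_le_sum fun a _ => ?_)
        refine (Finset.abs_sum_le_sum_abs _ _).trans (Finset.sum_le_sum fun c _ => ?_)
        have h1 := ht a c
        have h2 := mul_nonneg hB (hv a c)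
        by_cases ha : a = i <;> by_cases hc : c = i
        · subst ha; subst hc; simp; linarith
        · subst ha; simpa [hc] using h1
        · subst hc; simpa [ha] using h1
        · simp [ha, hc]
    _ = _ := by
        simp_rw [Finset.sum_add_distrib, mul_add, Finset.mul_sum]
        congr 1
        · rw [Finset.sum_comm]
          simp
        · simp

/-- Efron–Stein, where `g i` is the double sum without the terms that involve the index `i`. -/
lemma variance_stepSum_le (F : Model X) (p : ℕ) {k m : ℕ} (hk : 0 < k) (hm : 2 ≤ m) (bit : Bool)
    (z : Fin k → X) {w : Fin k → Fin k → ℝ} (hw : ∀ i j, 0 ≤ w i j) {φ : X × X → ℝ}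
    (hφ : Measurable φ) {B : ℝ} (hB : ∀ x, |φ x| ≤ B) (hB0 : 0 ≤ B) :
    ∫ y, stepSum F p bit z w φ y ^ 2 ∂(Measure.pi fun _ : Fin m => offspringKernel F p k z) -
      (∫ y, stepSum F p bit z w φ y ∂(Measure.pi fun _ : Fin m => offspringKernel F p k z)) ^ 2 ≤
      2 * B ^ 2 * ∫ y, marginSq (stepWeight F p bit z w (fun i => (y i).1))
        ∂(Measure.pi fun _ : Fin m => offspringKernel F p k z) := by
  have := isMarkovKernel_offspringKernel F p hk
  obtain ⟨C, hC0, hC⟩ := exists_stepWeight_le (m := m) F p bit z w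
  set ν := offspringKernel F p k z with hν
  set v : (Fin m → Fin k × X) → Fin m → Fin m → ℝ :=
    fun y => stepWeight F p bit z w (fun i => (y i).1) with hvdef
  have hv : ∀ y i j, 0 ≤ v y i j := fun y i j => stepWeight_nonneg F p hm bit z hw _ i j
  set t : (Fin m → Fin k × X) → Fin m → Fin m → ℝ :=
    fun y i j => v y i j * φ ((y i).2, (y j).2) with htdef
  have htm : ∀ i j, Measurable fun y => t y i j := fun i j =>
    (measurable_comp_ancestors fun a => stepWeight F p bit z w a i j).mul
      (measurable_apply_pair hφ i j)
  have htv : ∀ y i j, |t y i j| ≤ B * v y i j := fun y i j => by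
    rw [htdef, abs_mul, abs_of_nonneg (hv y i j), mul_comm]
    exact mul_le_mul_of_nonneg_right (hB _) (hv y i j)
  have htb : ∀ y i j, |t y i j| ≤ B * C := fun y i j =>
    (htv y i j).trans (mul_le_mul_of_nonneg_left ((le_abs_self _).trans (hC _ _ _)) hB0)
  have hfm : Measurable fun y => ∑ a, ∑ c, t y a c :=
    Finset.measurable_sum _ fun a _ => Finset.measurable_sum _ fun c _ => htm a c
  have hgm : ∀ i, Measurable fun y => ∑ a, ∑ c, if a = i ∨ c = i then 0 else t y a c := fun i =>
    Finset.measurable_sum _ fun a _ => Finset.measurable_sum _ fun c _ => by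
      split_ifs
      · exact measurable_const
      · exact htm a c
  have hES := efronStein ν hfm (C := m * (m * (B * C))) (fun y => abs_sum_sum_le (htb y))
    (g := fun i y => ∑ a, ∑ c, if a = i ∨ c = i then 0 else t y a c) hgm
    (fun i y => abs_sum_sum_le fun a c => by
      split_ifs
      · simpa using mul_nonneg hB0 hC0
      · exact htb y a c)
    (fun i y x => by
      refine Finset.sum_congr rfl fun a _ => Finset.sum_congr rfl fun c _ => ?_
      by_cases h : a = i ∨ c = i
      · rw [if_pos h, if_pos h]
      · rw [if_neg h, if_neg h]
        push Not at h
        -- The weight of the pair `(a, c)` depends on the ancestors of `a` and `c` only, hence not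
        -- on coordinate `i`.
        simp only [htdef, hvdef, stepWeight, Function.update_of_ne h.1, Function.update_of_ne h.2])
  refine hES.trans ?_
  have hsq : ∀ i, Integrable (fun y => (∑ j, v y i j) ^ 2 + (∑ j, v y j i) ^ 2)
      (Measure.pi fun _ : Fin m => ν) := fun i => by
    obtain ⟨D, hD⟩ := exists_abs_le_of_finite fun a : Fin m → Fin k =>
      (∑ j, stepWeight F p bit z w a i j) ^ 2 + (∑ j, stepWeight F p bit z w a j i) ^ 2
    exact integrable_of_measurable_of_bound (measurable_comp_ancestors fun a =>
      (∑ j, stepWeight F p bit z w a i j) ^ 2 + (∑ j, stepWeight F p bit z w a j i) ^ 2)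
      fun y => hD _
  have hstep : ∀ i, ∫ y, (∑ a, ∑ c, t y a c - ∑ a, ∑ c, if a = i ∨ c = i then 0 else t y a c) ^ 2
      ∂(Measure.pi fun _ : Fin m => ν) ≤
      ∫ y, 2 * B ^ 2 * ((∑ j, v y i j) ^ 2 + (∑ j, v y j i) ^ 2)
        ∂(Measure.pi fun _ : Fin m => ν) := fun i => by
    refine integral_mono_of_nonneg (ae_of_all _ fun y => sq_nonneg _) ((hsq i).const_mul _)
      (ae_of_all _ fun y => ?_)
    have h1 := sq_abs_le (abs_sum_sub_sum_erase_le (htv y) hB0 (hv y) i)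
    have h2 := (le_abs_self _).trans h1
    refine h2.trans ?_
    -- This is `(r + c) ^ 2 ≤ 2 * (r ^ 2 + c ^ 2)` for the row and column sums.
    have h3 := mul_nonneg (sq_nonneg B) (sq_nonneg (∑ j, v y i j - ∑ j, v y j i))
    simp only
    linarith
  refine (Finset.sum_le_sum fun i _ => hstep i).trans (le_of_eq ?_)
  simp_rw [integral_const_mul]
  rw [← Finset.mul_sum, ← integral_finsetSum _ fun i _ => hsq i]
  simp only [marginSq, rowSq, Finset.sum_add_distrib]
  rfl

/-! ### The recursion for `μ_b` -/

instance (F : Model X) (bit : Bool) : IsProbabilityMeasure (pairInit F bit) := by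
  unfold pairInit
  cases bit
  · simp only [Bool.false_eq_true, if_false]
    infer_instance
  · simp only [if_true]
    exact Measure.isProbabilityMeasure_map (measurable_id.prodMk measurable_id).aemeasurable

lemma measurable_snoc {α : Type*} [MeasurableSpace α] {n : ℕ} :
    Measurable fun y : (Fin (n + 1) → α) × α => (Fin.snoc y.1 y.2 : Fin (n + 2) → α) := by
  refine measurable_pi_iff.2 fun p => ?_
  refine Fin.lastCases ?_ (fun q => ?_) p
  · simp only [Fin.snoc_last]
    exact measurable_snd
  · simp only [Fin.snoc_castSucc]
    exact (measurable_pi_apply q).comp measurable_fst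

lemma isProbabilityMeasure_pairLaw (F : Model X) (n : ℕ) (b : Fin (n + 1) → Bool) :
    IsProbabilityMeasure (pairLaw F n b) := by
  induction n with
  | zero =>
    exact Measure.isProbabilityMeasure_map (measurable_pi_iff.2 fun _ => measurable_id).aemeasurable
  | succ n ih =>
    have := ih (Fin.init b)
    exact Measure.isProbabilityMeasure_map measurable_snoc.aemeasurable

lemma mu_zero (F : Model X) (b : Fin 1 → Bool) {φ : X × X → ℝ} (hφ : Measurable φ) :
    mu F 0 b φ = ∫ x, φ x ∂(pairInit F (b 0)) := by
  unfold mu pairLaw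
  have hm : Measurable fun (x : X × X) (_ : Fin 1) => x := measurable_pi_iff.2 fun _ => measurable_id
  rw [integral_map hm.aemeasurable]
  · simp
  · simp only [Finset.univ_eq_empty, Finset.prod_empty, mul_one]
    exact (hφ.comp (measurable_pi_apply _)).aestronglyMeasurable

/-- Integrating out the last pair given the path turns `φ`, together with the new factor `G_n(X_n)
G_n(X'_n)`, into `transfer φ` at time `n`: the same recursion as for the conditional mean of the
estimator. -/
lemma mu_succ (F : Model X) (n : ℕ) (b : Fin (n + 2) → Bool) {φ : X × X → ℝ}
    (hφ : Measurable φ) {B : ℝ} (hB : ∀ x, |φ x| ≤ B) :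
    mu F (n + 1) b φ = mu F n (Fin.init b) (transfer F n (b (Fin.last (n + 1))) φ) := by
  have := isProbabilityMeasure_pairLaw F n (Fin.init b)
  have hG : ∀ (m : ℕ) (p : Fin m), Measurable fun x : Fin (m + 1) → X × X =>
      F.G p (x p.castSucc).1 * F.G p (x p.castSucc).2 := fun m p =>
    ((F.measurable_G p).comp (measurable_fst.comp (measurable_pi_apply _))).mul
      ((F.measurable_G p).comp (measurable_snd.comp (measurable_pi_apply _)))
  have hm : Measurable fun x : Fin (n + 2) → X × X => φ (x (Fin.last (n + 1))) *
      ∏ p : Fin (n + 1), F.G p (x p.castSucc).1 * F.G p (x p.castSucc).2 :=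
    (hφ.comp (measurable_pi_apply _)).mul (Finset.measurable_prod _ fun p _ => hG (n + 1) p)
  choose g hg using F.G_bdd
  have hb : ∀ x : Fin (n + 2) → X × X, |φ (x (Fin.last (n + 1))) *
      ∏ p : Fin (n + 1), F.G p (x p.castSucc).1 * F.G p (x p.castSucc).2| ≤
      B * ∏ p : Fin (n + 1), g p * g p := fun x => by
    rw [abs_mul, Finset.abs_prod]
    have h0 : ∀ p (x : X), 0 ≤ g p := fun p x => (F.G_pos p x).le.trans (hg p x)
    refine mul_le_mul (hB _) (Finset.prod_le_prod (fun p _ => abs_nonneg _) fun p _ => ?_)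
      (Finset.prod_nonneg fun p _ => abs_nonneg _) ((abs_nonneg _).trans (hB (x 0)))
    rw [abs_of_pos (mul_pos (F.G_pos _ _) (F.G_pos _ _))]
    exact mul_le_mul (hg _ _) (hg _ _) (F.G_pos _ _).le (h0 _ (x 0).1)
  unfold mu
  rw [pairLaw, integral_map measurable_snoc.aemeasurable hm.aestronglyMeasurable]
  refine (Measure.integral_compProd
    (integrable_of_measurable_of_bound (hm.comp measurable_snoc) fun x => hb _)).trans ?_
  congr 1
  ext x
  simp only [Function.comp_apply, Fin.snoc_last, Fin.snoc_castSucc]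
  rw [integral_mul_const, Fin.prod_univ_castSucc, Kernel.comap_apply]
  unfold transfer
  simp only [Fin.val_last, Fin.val_castSucc]
  ring

/-! ### The initial step -/

/-- The model with constant potential `1` whose transitions all draw from `M₀`. Its first step
from a single particle produces the initial particles of `F`. -/
noncomputable def initialModel (F : Model X) : Model X where
  M₀ := F.M₀
  M := fun _ => Kernel.const X F.M₀
  G := fun _ _ => 1
  isProbabilityMeasure_M₀ := inferInstance
  isMarkovKernel_M := fun _ => inferInstance
  measurable_G := fun _ => measurable_const
  G_pos := fun _ _ => one_pos
  G_bdd := fun _ => ⟨1, fun _ => le_rfl⟩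

lemma map_snd_offspringKernel_initialModel (F : Model X) (z : Fin 1 → X) :
    (offspringKernel (initialModel F) 0 1 z).map Prod.snd = F.M₀ := by
  have := isMarkovKernel_offspringKernel (initialModel F) 0 (k := 1) one_pos
  ext s hs
  have hm : MeasurableSet (Prod.snd ⁻¹' s : Set (Fin 1 × X)) := measurable_snd hs
  have h1 := integral_offspringKernel (initialModel F) 0 z
    (f := (Prod.snd ⁻¹' s).indicator fun _ => 1) (measurable_const.indicator hm) (C := 1)
    fun x => by
      by_cases h : x ∈ (Prod.snd ⁻¹' s : Set (Fin 1 × X))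
      · rw [Set.indicator_of_mem h, abs_one]
      · rw [Set.indicator_of_notMem h, abs_zero]
        exact zero_le_one
  have h2 : (fun x : X => (Prod.snd ⁻¹' s : Set (Fin 1 × X)).indicator (fun _ => (1 : ℝ)) (0, x)) =
      s.indicator fun _ => 1 := rfl
  rw [Fin.sum_univ_one, h2, integral_indicator_const _ hm,
    show (initialModel F).M 0 (z 0) = F.M₀ from rfl, integral_indicator_const _ hs,
    show catProb (initialModel F) 0 z 0 = 1 by simp [catProb, initialModel]] at h1
  rw [Measure.map_apply measurable_snd hs]
  simpa [Measure.real, ENNReal.toReal_eq_toReal_iff'] using h1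

lemma integral_pi_initial (F : Model X) {m : ℕ} (z : Fin 1 → X) {f : (Fin m → X) → ℝ}
    (hf : Measurable f) :
    ∫ x, f x ∂(Measure.pi fun _ : Fin m => F.M₀) = ∫ y, f (fun i => (y i).2)
      ∂(Measure.pi fun _ : Fin m => offspringKernel (initialModel F) 0 1 z) := by
  have := isMarkovKernel_offspringKernel (initialModel F) 0 (k := 1) one_pos
  have hm : Measurable fun (y : Fin m → Fin 1 × X) (i : Fin m) => (y i).2 :=
    measurable_pi_iff.2 fun i => measurable_snd.comp (measurable_pi_apply i)
  have h : (Measure.pi fun _ : Fin m => offspringKernel (initialModel F) 0 1 z).map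
      (fun y i => (y i).2) = Measure.pi fun _ : Fin m => F.M₀ := by
    have := Measure.pi_map_pi (μ := fun _ : Fin m => offspringKernel (initialModel F) 0 1 z)
      (f := fun _ => Prod.snd) fun _ => measurable_snd.aemeasurable
    rw [this]
    simp_rw [map_snd_offspringKernel_initialModel]
  rw [← h, integral_map hm.aemeasurable hf.aestronglyMeasurable]

lemma integral_particleLaw_initial (F : Model X) {N : ℕ → ℕ} (z : Fin 1 → X)
    {f : System X N 0 → ℝ} (hf : Measurable f) :
    ∫ s, f s ∂(particleLaw F N 0) =
      ∫ y, f (finZeroElim, Fin.cons (fun i => (y i).2) finZeroElim)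
        ∂(Measure.pi fun _ : Fin (N 0) => offspringKernel (initialModel F) 0 1 z) :=
  (integral_particleLaw_zero F N hf).trans
    (integral_pi_initial F z (hf.comp measurable_initial))

/-- Both sides equal `1 / m` on the diagonal (bit 1) or `1 / (m * (m - 1))` off it (bit 0), so time
0 is a step from a single parent of weight 1, and the one-step estimates apply to it. -/
lemma pairWeight_zero (F : Model X) {N : ℕ → ℕ} (hN : 2 ≤ N 0) (b : Fin 1 → Bool)
    (s : System X N 0) (z : Fin 1 → X) (a : Fin (N 0) → Fin 1) (i j : Fin (N 0)) :
    pairWeight F b s i j = stepWeight (initialModel F) 0 (b 0) z (fun _ _ => 1) a i j := by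
  have h0 : (N 0 : ℝ) ≠ 0 := by positivity
  have h1 : (N 0 : ℝ) - 1 ≠ 0 := by
    have : (2 : ℝ) ≤ N 0 := by exact_mod_cast hN
    linarith
  unfold pairWeight
  have e : ∀ i : Fin (N 0), (Fin.cons (α := fun p : Fin 1 => Fin (N p)) i finZeroElim)
      (Fin.last 0) = i := fun i => rfl
  have e0 : ∀ i : Fin (N 0), (Fin.cons (α := fun p : Fin 1 => Fin (N p)) i finZeroElim)
      0 = i := fun i => rfl
  simp only [sum_lineage_zero, e]
  have h2 : ∀ i j : Fin (N 0),
      coincProb F b s (Fin.cons (α := fun p : Fin 1 => Fin (N p)) i finZeroElim)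
        (Fin.cons (α := fun p : Fin 1 => Fin (N p)) j finZeroElim) =
      (if (i = j ↔ b 0 = true) then 1 else 0) * ((N 0 : ℝ)⁻¹ * (N 0 : ℝ)⁻¹) := fun i j => by
    simp [coincProb, traceProb₁, traceProb₂, e0]
  have h3 := sum_sum_ite_eq (fun i j : Fin (N 0) =>
    coincProb F b s (Fin.cons (α := fun p : Fin 1 => Fin (N p)) i finZeroElim)
        (Fin.cons (α := fun p : Fin 1 => Fin (N p)) j finZeroElim)) i j
  simp only [eq_comm (b := i), eq_comm (b := j)] at h3
  rw [h3, h2, gammaN_one F (by omega)]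
  unfold bitFactor stepWeight
  cases hb : b 0 <;> by_cases hij : i = j <;> simp [hb, hij, initialModel] <;> field_simp

lemma estimator_initial (F : Model X) {N : ℕ → ℕ} (hN : 2 ≤ N 0) (b : Fin 1 → Bool)
    (φ : X × X → ℝ) (z : Fin 1 → X) (y : Fin (N 0) → Fin 1 × X) :
    estimator F b φ ((finZeroElim, Fin.cons (fun i => (y i).2) finZeroElim) : System X N 0) =
      stepSum (initialModel F) 0 (b 0) z (fun _ _ => 1) φ y := by
  unfold estimator stepSum
  refine Finset.sum_congr rfl fun i _ => Finset.sum_congr rfl fun j _ => ?_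
  rw [pairWeight_zero F hN b _ z fun i => (y i).1]
  rfl

lemma transfer_initialModel (F : Model X) (bit : Bool) {φ : X × X → ℝ} (hφ : Measurable φ)
    {B : ℝ} (hB : ∀ x, |φ x| ≤ B) (x : X × X) :
    transfer (initialModel F) 0 bit φ x = ∫ y, φ y ∂(pairInit F bit) := by
  have hd : Measurable fun y : X => (y, y) := measurable_id.prodMk measurable_id
  unfold transfer
  cases bit
  · rw [integral_pairKernel_false _ _ hφ hB]
    simp only [initialModel, pairInit, Bool.false_eq_true, if_false, Kernel.const_apply]
    rw [integral_prod _ (integrable_of_measurable_of_bound hφ hB)]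
    ring
  · rw [integral_pairKernel_true _ _ hφ]
    simp only [initialModel, pairInit, if_true, Kernel.const_apply]
    rw [integral_map hd.aemeasurable hφ.aestronglyMeasurable]
    ring

lemma estimator_extend (F : Model X) {N : ℕ → ℕ} {n : ℕ} (hN : 0 < N n) (hN' : 2 ≤ N (n + 1))
    (b : Fin (n + 2) → Bool) (φ : X × X → ℝ) (s : System X N n)
    (y : Fin (N (n + 1)) → Fin (N n) × X) :
    estimator F b φ (s.extend y) = stepSum F n (b (Fin.last (n + 1))) (s.2 (Fin.last n))
      (pairWeight F (Fin.init b) s) φ y := by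
  unfold estimator stepSum
  refine Finset.sum_congr rfl fun i _ => Finset.sum_congr rfl fun j _ => ?_
  rw [pairWeight_extend F hN hN', extend_snd_last]

/-! ### Lack of bias -/

lemma integral_estimator_extend (F : Model X) {N : ℕ → ℕ} {n : ℕ} (hN : 0 < N n)
    (hN' : 2 ≤ N (n + 1)) (b : Fin (n + 2) → Bool) {φ : X × X → ℝ} (hφ : Measurable φ) {B : ℝ}
    (hB : ∀ x, |φ x| ≤ B) (s : System X N n) :
    ∫ y, estimator F b φ (s.extend y) ∂(stepLaw F s) =
      estimator F (Fin.init b) (transfer F n (b (Fin.last (n + 1))) φ) s := by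
  simp_rw [estimator_extend F hN hN']
  exact integral_stepSum F n hN hN' _ _ _ hφ hB

theorem integral_estimator (F : Model X) {N : ℕ → ℕ} (n : ℕ) (hN : ∀ p ≤ n, 2 ≤ N p)
    (b : Fin (n + 1) → Bool) {φ : X × X → ℝ} (hφ : Measurable φ) {B : ℝ} (hB : ∀ x, |φ x| ≤ B) :
    ∫ s, estimator F b φ s ∂(particleLaw F N n) = mu F n b φ := by
  -- The test function must vary: the step replaces `φ` by its transfer, with another bound.
  induction n generalizing φ B with
  | zero =>
    obtain ⟨x⟩ := nonempty_of_isProbabilityMeasure F.M₀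
    rw [integral_particleLaw_initial F (fun _ => x) (measurable_estimator F b hφ), mu_zero F b hφ]
    simp only [estimator_initial F (hN 0 le_rfl) b φ fun _ => x]
    rw [integral_stepSum _ _ one_pos (hN 0 le_rfl) _ _ _ hφ hB]
    simp [transfer_initialModel F _ hφ hB]
  | succ n ih =>
    have hN0 : ∀ p ≤ n, 0 < N p := fun p hp => lt_of_lt_of_le two_pos (hN p (by omega))
    obtain ⟨C, hC⟩ := exists_estimator_le F hN b hB
    obtain ⟨g, hg⟩ := F.G_bdd n
    rw [integral_particleLaw_succ F N n hN0 (measurable_estimator F b hφ) hC]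
    simp_rw [integral_estimator_extend F (hN0 n le_rfl) (hN _ le_rfl) b hφ hB]
    rw [ih (fun p hp => hN p (by omega)) (Fin.init b) (measurable_transfer F n _ hφ)
      (fun x => abs_transfer_le F n _ hB hg x), mu_succ F n b hφ hB]

/-! ### The mean square error -/

lemma marginSq_nonneg {m : ℕ} (w : Fin m → Fin m → ℝ) : 0 ≤ marginSq w :=
  add_nonneg (rowSq_nonneg _) (rowSq_nonneg _)

lemma measurable_marginSq_pairWeight (F : Model X) {N : ℕ → ℕ} {n : ℕ} (b : Fin (n + 1) → Bool) :
    Measurable fun s : System X N n => marginSq (pairWeight F b s) :=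
  (Finset.measurable_sum _ fun i _ => (Finset.measurable_sum _ fun j _ =>
    measurable_pairWeight F b i j).pow_const 2).add
    (Finset.measurable_sum _ fun i _ => (Finset.measurable_sum _ fun j _ =>
      measurable_pairWeight F b j i).pow_const 2)

lemma rowSq_le {m : ℕ} {w : Fin m → Fin m → ℝ} {C : ℝ} (hC : ∀ i j, |w i j| ≤ C) :
    rowSq w ≤ m * (m * C) ^ 2 := by
  refine (Finset.sum_le_card_nsmul _ _ ((m * C) ^ 2) fun i _ => ?_).trans (by simp)
  refine (le_abs_self _).trans (sq_abs_le ?_)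
  exact (Finset.abs_sum_le_sum_abs _ _).trans
    ((Finset.sum_le_card_nsmul _ _ C fun j _ => hC i j).trans (by simp))

lemma exists_marginSq_pairWeight_le (F : Model X) {N : ℕ → ℕ} {n : ℕ} (hN : ∀ p ≤ n, 2 ≤ N p)
    (b : Fin (n + 1) → Bool) :
    ∃ C : ℝ, ∀ s : System X N n, |marginSq (pairWeight F b s)| ≤ C := by
  obtain ⟨C, hC⟩ := exists_pairWeight_le F hN b
  refine ⟨N n * (N n * C) ^ 2 + N n * (N n * C) ^ 2, fun s => ?_⟩
  rw [abs_of_nonneg (marginSq_nonneg _)]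
  exact add_le_add (rowSq_le (hC s)) (rowSq_le fun i j => hC s j i)

lemma integral_marginSq_initial (F : Model X) {m : ℕ} (hm : 2 ≤ m) (bit : Bool) (z : Fin 1 → X) :
    m * ∫ y, marginSq (stepWeight (initialModel F) 0 bit z (fun _ _ => 1) (fun i => (y i).1))
      ∂(Measure.pi fun _ : Fin m => offspringKernel (initialModel F) 0 1 z) ≤ 8 := by
  have hm2 : (2 : ℝ) ≤ m := by exact_mod_cast hm
  -- `k = 1 ≤ m - 1` allows `ρ = 1`, and the 1×1 matrix of ones has `marginSq = 2`; hence `2 * (1 +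
  -- 1) * 2 = 8`.
  have h := integral_marginSq_stepWeight (initialModel F) 0 one_pos hm bit z (g := 1)
    (fun _ => le_rfl) zero_le_one (ρ := 1) (by simp; linarith) (w := fun _ _ => 1)
    (fun _ _ => zero_le_one)
  refine h.trans (le_of_eq ?_)
  simp [marginSq, rowSq]
  norm_num

/-- The source of the rate `1 / N`: the bound involves the particle numbers only through `ρ`. -/
lemma integral_marginSq_pairWeight (F : Model X) {N : ℕ → ℕ} (n : ℕ) (hN : ∀ p ≤ n, 2 ≤ N p)
    {g ρ : ℝ} (hg : ∀ p < n, ∀ x, F.G p x ≤ g) (hg0 : 0 ≤ g) (hρ0 : 0 ≤ ρ)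
    (hρ : ∀ p < n, (N p : ℝ) ≤ ρ * (N (p + 1) - 1)) (b : Fin (n + 1) → Bool) :
    N n * ∫ s, marginSq (pairWeight F b s) ∂(particleLaw F N n) ≤
      (2 * g ^ 4 * (1 + ρ)) ^ n * 8 := by
  induction n with
  | zero =>
    obtain ⟨x⟩ := nonempty_of_isProbabilityMeasure F.M₀
    rw [integral_particleLaw_initial F (fun _ => x) (measurable_marginSq_pairWeight F b)]
    have e : ∀ y : Fin (N 0) → Fin 1 × X, pairWeight F b
        ((finZeroElim, Fin.cons (fun i => (y i).2) finZeroElim) : System X N 0) =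
        stepWeight (initialModel F) 0 (b 0) (fun _ => x) (fun _ _ => 1) fun i => (y i).1 := by
      intro y
      ext i j
      exact pairWeight_zero F (hN 0 le_rfl) b _ _ _ i j
    simp_rw [e, pow_zero, one_mul]
    exact integral_marginSq_initial F (hN 0 le_rfl) (b 0) fun _ => x
  | succ n ih =>
    have hN0 : ∀ p ≤ n, 0 < N p := fun p hp => lt_of_lt_of_le two_pos (hN p (by omega))
    have := isProbabilityMeasure_particleLaw F N n fun p hp => hN0 p hp.le
    obtain ⟨C, hC⟩ := exists_marginSq_pairWeight_le F hN b
    obtain ⟨D, hD⟩ := exists_marginSq_pairWeight_le F (fun p hp => hN p (by omega)) (Fin.init b)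
    have ih' := ih (fun p hp => hN p (by omega)) (fun p hp => hg p (by omega))
      (fun p hp => hρ p (by omega)) (Fin.init b)
    rw [integral_particleLaw_succ F N n hN0 (measurable_marginSq_pairWeight F b) hC,
      ← integral_const_mul]
    have hstep : ∀ s : System X N n, N (n + 1) * ∫ y, marginSq (pairWeight F b (s.extend y))
        ∂(stepLaw F s) ≤
        2 * g ^ 4 * (1 + ρ) * (N n * marginSq (pairWeight F (Fin.init b) s)) := by
      intro s
      have e : ∀ y, pairWeight F b (s.extend y) = stepWeight F n (b (Fin.last (n + 1)))
          (s.2 (Fin.last n)) (pairWeight F (Fin.init b) s) (fun i => (y i).1) := fun y => by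
        ext i j
        exact pairWeight_extend F (hN0 n le_rfl) (hN _ le_rfl) b s y i j
      simp_rw [e]
      exact integral_marginSq_stepWeight F n (hN0 n le_rfl) (hN _ le_rfl) _ _
        (hg n (by omega)) hg0 (hρ n (by omega))
        (pairWeight_nonneg F (fun p hp => hN p (by omega)) (Fin.init b) s)
    refine (integral_mono_of_nonneg (ae_of_all _ fun s => ?_) ?_ (ae_of_all _ hstep)).trans ?_
    · exact mul_nonneg (by positivity) (integral_nonneg fun y => marginSq_nonneg _)
    · exact ((integrable_of_measurable_of_bound (measurable_marginSq_pairWeight F _)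
        hD).const_mul _).const_mul _
    · rw [integral_const_mul, integral_const_mul, pow_succ' (2 * g ^ 4 * (1 + ρ)), mul_assoc _ _ 8]
      exact mul_le_mul_of_nonneg_left ih' (by positivity)

/-- Conditional bias–variance split: Efron–Stein bounds the variance, and the conditional mean is
the estimator of `transfer φ` one time earlier. -/
lemma integral_stepLaw_sub_sq_le (F : Model X) {N : ℕ → ℕ} (n : ℕ) (hN : ∀ p ≤ n + 1, 2 ≤ N p)
    (b : Fin (n + 2) → Bool) {φ : X × X → ℝ} (hφ : Measurable φ) {B : ℝ} (hB : ∀ x, |φ x| ≤ B)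
    (hB0 : 0 ≤ B) (c : ℝ) (s : System X N n) :
    ∫ y, (estimator F b φ (s.extend y) - c) ^ 2 ∂(stepLaw F s) ≤
      2 * B ^ 2 * ∫ y, marginSq (pairWeight F b (s.extend y)) ∂(stepLaw F s) +
        (estimator F (Fin.init b) (transfer F n (b (Fin.last (n + 1))) φ) s - c) ^ 2 := by
  have hNn : 0 < N n := lt_of_lt_of_le two_pos (hN n (by omega))
  have := isProbabilityMeasure_stepLaw F hNn s
  obtain ⟨C, hC⟩ := exists_estimator_le F hN b hB
  have hm : Measurable fun y => estimator F b φ (s.extend y) :=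
    (measurable_estimator F b hφ).comp (measurable_extend.comp measurable_prodMk_left)
  rw [integral_sub_const_sq hm fun y => hC _,
    ← integral_estimator_extend F hNn (hN _ le_rfl) b hφ hB]
  have e : ∀ y, pairWeight F b (s.extend y) = stepWeight F n (b (Fin.last (n + 1)))
      (s.2 (Fin.last n)) (pairWeight F (Fin.init b) s) (fun i => (y i).1) := fun y => by
    ext i j
    exact pairWeight_extend F hNn (hN _ le_rfl) b s y i j
  have hv := variance_stepSum_le F n hNn (hN (n + 1) le_rfl) (b (Fin.last (n + 1)))
    (s.2 (Fin.last n)) (pairWeight_nonneg F (fun p hp => hN p (by omega)) (Fin.init b) s) hφ hB hB0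
  simp only [estimator_extend F hNn (hN _ le_rfl), e]
  unfold stepLaw
  exact add_le_add hv le_rfl

lemma integral_sub_sq_succ_le (F : Model X) {N : ℕ → ℕ} (n : ℕ) (hN : ∀ p ≤ n + 1, 2 ≤ N p)
    (b : Fin (n + 2) → Bool) {φ : X × X → ℝ} (hφ : Measurable φ) {B g : ℝ}
    (hB : ∀ x, |φ x| ≤ B) (hg : ∀ x, F.G n x ≤ g) (hB0 : 0 ≤ B) (c : ℝ) :
    ∫ s, (estimator F b φ s - c) ^ 2 ∂(particleLaw F N (n + 1)) ≤
      2 * B ^ 2 * ∫ s, marginSq (pairWeight F b s) ∂(particleLaw F N (n + 1)) +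
        ∫ s, (estimator F (Fin.init b) (transfer F n (b (Fin.last (n + 1))) φ) s - c) ^ 2
          ∂(particleLaw F N n) := by
  have hN0 : ∀ p ≤ n, 0 < N p := fun p hp => lt_of_lt_of_le two_pos (hN p (by omega))
  have := isProbabilityMeasure_particleLaw F N n fun p hp => hN0 p hp.le
  have hest := measurable_estimator (N := N) F b hφ
  obtain ⟨C, hC⟩ := exists_estimator_le F hN b hB
  obtain ⟨D, hD⟩ := exists_estimator_le F (fun p hp => hN p (by omega)) (Fin.init b)
    (abs_transfer_le F n (b (Fin.last (n + 1))) hB hg)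
  obtain ⟨E, hE⟩ := exists_marginSq_pairWeight_le F hN b
  have hmg := measurable_marginSq_pairWeight (N := N) F b
  have hCc : ∀ s : System X N (n + 1), |(estimator F b φ s - c) ^ 2| ≤ (C + |c|) ^ 2 := fun s =>
    sq_abs_le ((abs_sub _ _).trans (add_le_add (hC s) le_rfl))
  have hi1 : Integrable (fun s => ∫ y, marginSq (pairWeight F b (s.extend y)) ∂(stepLaw F s))
      (particleLaw F N n) :=
    integrable_of_measurable_of_bound (C := E)
      (measurable_integral_stepLaw F N n hmg (hN0 n le_rfl)) fun s => by
        have := isProbabilityMeasure_stepLaw F (hN0 n le_rfl) s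
        exact abs_integral_le_of_bound fun y => hE _
  have hi2 : Integrable (fun s => (estimator F (Fin.init b)
      (transfer F n (b (Fin.last (n + 1))) φ) s - c) ^ 2) (particleLaw F N n) :=
    integrable_of_measurable_of_bound (C := (D + |c|) ^ 2)
      (((measurable_estimator F _ (measurable_transfer F n _ hφ)).sub_const _).pow_const 2)
      fun s => sq_abs_le ((abs_sub _ _).trans (add_le_add (hD s) le_rfl))
  rw [integral_particleLaw_succ F N n hN0 ((hest.sub_const c).pow_const 2) hCc,
    integral_particleLaw_succ F N n hN0 hmg hE, ← integral_const_mul,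
    ← integral_add (hi1.const_mul _) hi2]
  exact integral_mono_of_nonneg (ae_of_all _ fun s => integral_nonneg fun y => sq_nonneg _)
    ((hi1.const_mul _).add hi2)
    (ae_of_all _ fun s => integral_stepLaw_sub_sq_le F n hN b hφ hB hB0 c s)

theorem exists_mse_le (F : Model X) (n : ℕ) {g ρ δ : ℝ} (hg : ∀ p < n, ∀ x, F.G p x ≤ g)
    -- The constant is chosen before the particle numbers, `b` and `φ`. Here `L` stands for the size
    -- `N`, and `δ` converts `L` into each particle number.
    (hg0 : 0 ≤ g) (hρ0 : 0 ≤ ρ) (hδ0 : 0 ≤ δ) {B : ℝ} (hB0 : 0 ≤ B) :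
    ∃ C : ℝ, ∀ (N : ℕ → ℕ) (L : ℝ), 0 ≤ L → (∀ p ≤ n, 2 ≤ N p) →
      (∀ p < n, (N p : ℝ) ≤ ρ * (N (p + 1) - 1)) → (∀ p ≤ n, L ≤ δ * N p) →
      ∀ (b : Fin (n + 1) → Bool) (φ : X × X → ℝ), Measurable φ → (∀ x, |φ x| ≤ B) →
        L * ∫ s, (estimator F b φ s - mu F n b φ) ^ 2 ∂(particleLaw F N n) ≤ C := by
  induction n generalizing B with
  | zero =>
    refine ⟨2 * B ^ 2 * (δ * 8), fun N L hL hN _ hδ b φ hφ hB => ?_⟩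
    obtain ⟨x⟩ := nonempty_of_isProbabilityMeasure F.M₀
    have := isMarkovKernel_offspringKernel (initialModel F) 0 (k := 1) one_pos
    have hest := measurable_estimator (N := N) F b hφ
    obtain ⟨C, hC⟩ := exists_estimator_le F hN b hB
    have hmean := integral_estimator F 0 hN b hφ hB
    rw [integral_particleLaw_initial F (fun _ => x) ((hest.sub_const _).pow_const 2)]
    rw [integral_particleLaw_initial F (fun _ => x) hest] at hmean
    have hm : Measurable fun y : Fin (N 0) → Fin 1 × X => estimator F b φ
        ((finZeroElim, Fin.cons (fun i => (y i).2) finZeroElim) : System X N 0) :=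
      (hest.comp measurable_initial).comp
        (measurable_pi_iff.2 fun i => measurable_snd.comp (measurable_pi_apply i))
    -- The estimator is unbiased, so at time 0 the mean square error is the variance.
    rw [integral_sub_const_sq hm (fun y => hC _), hmean, sub_self, ← hmean]
    simp only [estimator_initial F (hN 0 le_rfl) b φ fun _ => x]
    have hv := variance_stepSum_le (initialModel F) 0 one_pos (hN 0 le_rfl) (b 0) (fun _ => x)
      (w := fun _ _ => 1) (fun _ _ => zero_le_one) hφ hB hB0
    have hI := integral_marginSq_initial F (hN 0 le_rfl) (b 0) fun _ => x
    set I := ∫ y, marginSq (stepWeight (initialModel F) 0 (b 0) (fun _ => x) (fun _ _ => 1)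
      (fun i => (y i).1)) ∂(Measure.pi fun _ : Fin (N 0) =>
        offspringKernel (initialModel F) 0 1 fun _ => x) with hIdef
    have hI0 : 0 ≤ I := integral_nonneg fun y => marginSq_nonneg _
    rw [zero_pow two_ne_zero, add_zero]
    calc _ ≤ L * (2 * B ^ 2 * I) := mul_le_mul_of_nonneg_left hv hL
      _ = 2 * B ^ 2 * (L * I) := by ring
      _ ≤ 2 * B ^ 2 * (δ * N 0 * I) := by
          have := hδ 0 le_rfl
          gcongr
      _ = 2 * B ^ 2 * (δ * (N 0 * I)) := by ring
      _ ≤ _ := by gcongr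
  | succ n ih =>
    -- `transfer` multiplies the sup bound by at most `g * g`, and `μ_b` is unchanged when `φ` is
    -- transferred, so both errors share the centre `c`.
    obtain ⟨C₀, hC₀⟩ := ih (fun p hp => hg p (by omega)) (B := g * g * B) (by positivity)
    refine ⟨2 * B ^ 2 * (δ * ((2 * g ^ 4 * (1 + ρ)) ^ (n + 1) * 8)) + C₀,
      fun N L hL hN hρ hδ b φ hφ hB => ?_⟩
    have hN' : ∀ p ≤ n, 2 ≤ N p := fun p hp => hN p (by omega)
    set ψ := transfer F n (b (Fin.last (n + 1))) φ with hψ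
    have hψm : Measurable ψ := measurable_transfer F n _ hφ
    have hψB : ∀ x, |ψ x| ≤ g * g * B := abs_transfer_le F n _ hB (hg n (by omega))
    have hih := hC₀ N L hL hN' (fun p hp => hρ p (by omega)) (fun p hp => hδ p (by omega))
      (Fin.init b) ψ hψm hψB
    have hinv := integral_marginSq_pairWeight F (n + 1) hN hg hg0 hρ0 hρ b
    set I := ∫ s, marginSq (pairWeight F b s) ∂(particleLaw F N (n + 1)) with hIdef
    have hI0 : 0 ≤ I := integral_nonneg fun y => marginSq_nonneg _
    rw [mu_succ F n b hφ hB, ← hψ]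
    set c := mu F n (Fin.init b) ψ with hc
    have hsplit := integral_sub_sq_succ_le F n hN b hφ hB (hg n (by omega)) hB0 c
    rw [← hψ, ← hIdef] at hsplit
    calc _ ≤ L * (2 * B ^ 2 * I +
          ∫ s, (estimator F (Fin.init b) ψ s - c) ^ 2 ∂(particleLaw F N n)) :=
          mul_le_mul_of_nonneg_left hsplit hL
      _ = 2 * B ^ 2 * (L * I) +
          L * ∫ s, (estimator F (Fin.init b) ψ s - c) ^ 2 ∂(particleLaw F N n) := by ring
      _ ≤ 2 * B ^ 2 * (δ * N (n + 1) * I) + C₀ := by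
          have := hδ (n + 1) le_rfl
          gcongr
      _ = 2 * B ^ 2 * (δ * (N (n + 1) * I)) + C₀ := by ring
      _ ≤ _ := by gcongr

/-! ### Consequences for `μ_b^N` -/

lemma exists_G_le (F : Model X) (n : ℕ) : ∃ g : ℝ, 0 ≤ g ∧ ∀ p < n, ∀ x, F.G p x ≤ g := by
  choose C hC using F.G_bdd
  refine ⟨∑ p ∈ Finset.range n, |C p|, Finset.sum_nonneg fun _ _ => abs_nonneg _,
    fun p hp x => ((hC p x).trans (le_abs_self _)).trans ?_⟩
  exact Finset.single_le_sum (f := fun p => |C p|) (fun _ _ => abs_nonneg _)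
    (Finset.mem_range.2 hp)

/-! ### Uniform comparison of the particle numbers with `N` and with each other. -/

lemma exists_le_mul_particleNumber {c : ℕ → ℝ} {n : ℕ} (hc : ∀ p ≤ n, 0 < c p) :
    ∃ δ : ℝ, 0 ≤ δ ∧ ∀ N : ℕ, ∀ p ≤ n, (N : ℝ) ≤ δ * particleNumber c N p := by
  have hmem : ∀ p, p ∈ Finset.range (n + 1) ↔ p ≤ n := fun p => by simp
  have h0 : ∀ p ∈ Finset.range (n + 1), 0 ≤ (c p)⁻¹ := fun p hp =>
    (inv_pos.2 (hc p ((hmem p).1 hp))).le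
  refine ⟨∑ p ∈ Finset.range (n + 1), (c p)⁻¹, Finset.sum_nonneg h0, fun N p hp => ?_⟩
  have h1 := Finset.single_le_sum h0 ((hmem p).2 hp)
  have h2 : c p * N ≤ particleNumber c N p := Nat.le_ceil _
  have hcp := hc p hp
  calc (N : ℝ) = (c p)⁻¹ * (c p * N) := by field_simp
    _ ≤ _ := mul_le_mul h1 h2 (by positivity) (Finset.sum_nonneg h0)

/-- Admissibility matters here: `2 ≤ N_{p+1}` gives `N_{p+1} ≤ 2 * (N_{p+1} - 1)`, while `N ≥ 1`
gives `N_p ≤ (c_p + 1) * N`. The sum over `p` is a crude substitute for a maximum. -/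
lemma exists_particleNumber_le_mul {c : ℕ → ℝ} {n : ℕ} (hc : ∀ p ≤ n, 0 < c p) :
    ∃ ρ : ℝ, 0 ≤ ρ ∧ ∀ N : ℕ, 1 ≤ N → (∀ p ≤ n, 2 ≤ particleNumber c N p) → ∀ p < n,
      (particleNumber c N p : ℝ) ≤ ρ * (particleNumber c N (p + 1) - 1) := by
  have h0 : ∀ p ∈ Finset.range n, 0 ≤ (c p + 1) * (2 * (c (p + 1))⁻¹) := fun p hp => by
    have hp := Finset.mem_range.1 hp
    have h1 := hc p (by omega)
    have h2 := hc (p + 1) (by omega)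
    positivity
  refine ⟨∑ p ∈ Finset.range n, (c p + 1) * (2 * (c (p + 1))⁻¹), Finset.sum_nonneg h0,
    fun N hN1 hN p hp => ?_⟩
  have h1 := Finset.single_le_sum h0 (Finset.mem_range.2 hp)
  have hcp := hc p (by omega)
  have hcp' := hc (p + 1) (by omega)
  have hN1' : (1 : ℝ) ≤ N := by exact_mod_cast hN1
  have h2 : c (p + 1) * N ≤ particleNumber c N (p + 1) := Nat.le_ceil _
  have h3 : (particleNumber c N p : ℝ) < c p * N + 1 := Nat.ceil_lt_add_one (by positivity)
  have h4 : (2 : ℝ) ≤ particleNumber c N (p + 1) := by exact_mod_cast hN (p + 1) (by omega)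
  have h5 : (N : ℝ) ≤ 2 * (c (p + 1))⁻¹ * (particleNumber c N (p + 1) - 1) := by
    calc (N : ℝ) = (c (p + 1))⁻¹ * (c (p + 1) * N) := by field_simp
      _ ≤ (c (p + 1))⁻¹ * (2 * (particleNumber c N (p + 1) - 1)) :=
          mul_le_mul_of_nonneg_left (by linarith) (inv_pos.2 hcp').le
      _ = _ := by ring
  calc (particleNumber c N p : ℝ) ≤ (c p + 1) * N := by linarith
    _ ≤ (c p + 1) * (2 * (c (p + 1))⁻¹ * (particleNumber c N (p + 1) - 1)) := by gcongr
    _ = (c p + 1) * (2 * (c (p + 1))⁻¹) * (particleNumber c N (p + 1) - 1) := by ring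
    _ ≤ _ := mul_le_mul_of_nonneg_right h1 (by linarith)

lemma eventually_two_le_particleNumber {c : ℕ → ℝ} {n : ℕ} (hc : ∀ p ≤ n, 0 < c p) :
    ∀ᶠ N : ℕ in atTop, ∀ p ≤ n, 2 ≤ particleNumber c N p := by
  obtain ⟨δ, hδ0, hδ⟩ := exists_le_mul_particleNumber hc
  filter_upwards [tendsto_natCast_atTop_atTop.eventually_gt_atTop δ] with N hN p hp
  by_contra! h
  have h1 : (particleNumber c N p : ℝ) ≤ 1 := by exact_mod_cast Nat.lt_succ_iff.1 h
  have h2 := hδ N p hp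
  nlinarith

section

variable (F : Model X) {N : ℕ → ℕ} {n : ℕ} (b : Fin (n + 1) → Bool) {φ : X × X → ℝ}

lemma isProbabilityMeasure_jointLaw (hN : ∀ p ≤ n, 0 < N p) :
    IsProbabilityMeasure (jointLaw F N n) := by
  have := isProbabilityMeasure_particleLaw F N n fun p hp => hN p hp.le
  have := isMarkovKernel_traceKernel F N n hN
  unfold jointLaw
  infer_instance

lemma memLp_muN (hN : ∀ p ≤ n, 2 ≤ N p) (hφ : Measurable φ) {B : ℝ} (hB : ∀ x, |φ x| ≤ B)
    (q : ENNReal) : MemLp (muN F N n b φ) q (jointLaw F N n) := by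
  have hN0 : ∀ p ≤ n, 0 < N p := fun p hp => lt_of_lt_of_le two_pos (hN p hp)
  have := isProbabilityMeasure_jointLaw F hN0
  obtain ⟨C, hC⟩ := exists_estimator_le F hN b hB
  refine (memLp_congr_ae (muN_ae_eq F N n hN0 b hφ hB)).2 ?_
  exact MemLp.of_bound ((measurable_estimator F b hφ).comp measurable_fst).aestronglyMeasurable C
    (ae_of_all _ fun ω => hC _)

lemma integral_muN (hN : ∀ p ≤ n, 2 ≤ N p) (hφ : Measurable φ) {B : ℝ} (hB : ∀ x, |φ x| ≤ B) :
    ∫ ω, muN F N n b φ ω ∂(jointLaw F N n) = mu F n b φ := by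
  have hN0 : ∀ p ≤ n, 0 < N p := fun p hp => lt_of_lt_of_le two_pos (hN p hp)
  rw [integral_congr_ae (muN_ae_eq F N n hN0 b hφ hB),
    integral_jointLaw_fst F N n hN0 (measurable_estimator F b hφ),
    integral_estimator F n hN b hφ hB]

lemma integral_muN_sub_sq (hN : ∀ p ≤ n, 2 ≤ N p) (hφ : Measurable φ) {B : ℝ}
    (hB : ∀ x, |φ x| ≤ B) :
    ∫ ω, (muN F N n b φ ω - mu F n b φ) ^ 2 ∂(jointLaw F N n) =
      ∫ s, (estimator F b φ s - mu F n b φ) ^ 2 ∂(particleLaw F N n) := by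
  have hN0 : ∀ p ≤ n, 0 < N p := fun p hp => lt_of_lt_of_le two_pos (hN p hp)
  rw [← integral_jointLaw_fst F N n hN0
    (((measurable_estimator F b hφ).sub_const (mu F n b φ)).pow_const 2)]
  refine integral_congr_ae ?_
  filter_upwards [muN_ae_eq F N n hN0 b hφ hB] with ω hω
  rw [hω]

end

/-- Convergence to zero of the tails of `f N` from `N * E (f N)² ≤ C`. -/
lemma tendsto_measure_ge_of_mul_integral_sq_le {Ω : ℕ → Type*} [∀ N, MeasurableSpace (Ω N)]
    (P : ∀ N, Measure (Ω N)) (f : ∀ N, Ω N → ℝ) (C : ℝ)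
    (h : ∀ᶠ N in atTop, IsFiniteMeasure (P N) ∧ MemLp (f N) 2 (P N) ∧
      N * ∫ ω, f N ω ^ 2 ∂(P N) ≤ C) {ε : ℝ} (hε : 0 < ε) :
    Tendsto (fun N => P N {ω | ε ≤ |f N ω|}) atTop (𝓝 0) := by
  have hlim : Tendsto (fun N : ℕ => ENNReal.ofReal (C / ε ^ 2 / N)) atTop (𝓝 0) := by
    rw [← ENNReal.ofReal_zero]
    exact ENNReal.tendsto_ofReal (tendsto_const_div_atTop_nhds_zero_nat _)
  refine tendsto_of_tendsto_of_tendsto_of_le_of_le' tendsto_const_nhds hlim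
    (Eventually.of_forall fun N => zero_le) ?_
  filter_upwards [h, eventually_ge_atTop 1] with N hN hN1
  obtain ⟨hfin, hL, hle⟩ := hN
  have hN0 : (0 : ℝ) < N := by exact_mod_cast hN1
  -- Chebyshev: Markov's inequality for the square gives the tail bound `C / (ε ^ 2 * N)`.
  have h1 := mul_meas_ge_le_integral_of_nonneg (ae_of_all _ fun ω => sq_nonneg (f N ω))
    hL.integrable_sq (ε ^ 2)
  have h2 : {ω | ε ^ 2 ≤ f N ω ^ 2} = {ω | ε ≤ |f N ω|} := by
    ext ω
    simp only [Set.mem_ofPred_eq]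
    rw [sq_le_sq, abs_of_pos hε]
  rw [h2] at h1
  rw [← ENNReal.ofReal_toReal (measure_ne_top (P N) _)]
  refine ENNReal.ofReal_le_ofReal ?_
  change (P N).real _ ≤ _
  rw [le_div_iff₀ hN0, le_div_iff₀ (by positivity)]
  calc _ = N * (ε ^ 2 * (P N).real {ω | ε ≤ |f N ω|}) := by ring
    _ ≤ N * ∫ ω, f N ω ^ 2 ∂(P N) := by gcongr
    _ ≤ C := hle

end ParticleFilter

theorem theorem2 {X : Type*} [MeasurableSpace X] (F : ParticleFilter.Model X) (n : ℕ)
    (c : ℕ → ℝ) (hc : ∀ p ≤ n, 0 < c p) (b : Fin (n + 1) → Bool)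
    (φ : X × X → ℝ) (hφ : Measurable φ) (hφb : ∃ C, ∀ x, |φ x| ≤ C) :
    (∀ N : ℕ, 1 ≤ N → (∀ p ≤ n, 2 ≤ ParticleFilter.particleNumber c N p) →
      MeasureTheory.Integrable
        (ParticleFilter.muN F (ParticleFilter.particleNumber c N) n b φ)
        (ParticleFilter.jointLaw F (ParticleFilter.particleNumber c N) n) ∧
      ∫ ω, ParticleFilter.muN F (ParticleFilter.particleNumber c N) n b φ ω
        ∂(ParticleFilter.jointLaw F (ParticleFilter.particleNumber c N) n) =
        ParticleFilter.mu F n b φ) ∧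
    (∃ C : ℝ, ∀ N : ℕ, 1 ≤ N → (∀ p ≤ n, 2 ≤ ParticleFilter.particleNumber c N p) →
      MeasureTheory.MemLp
        (ParticleFilter.muN F (ParticleFilter.particleNumber c N) n b φ) 2
        (ParticleFilter.jointLaw F (ParticleFilter.particleNumber c N) n) ∧
      (N : ℝ) * ∫ ω, (ParticleFilter.muN F (ParticleFilter.particleNumber c N) n b φ ω -
          ParticleFilter.mu F n b φ) ^ 2
        ∂(ParticleFilter.jointLaw F (ParticleFilter.particleNumber c N) n) ≤ C) ∧
    (∀ ε : ℝ, 0 < ε → Filter.Tendsto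
      (fun N : ℕ => ParticleFilter.jointLaw F (ParticleFilter.particleNumber c N) n
        {ω | ε ≤ |ParticleFilter.muN F (ParticleFilter.particleNumber c N) n b φ ω -
          ParticleFilter.mu F n b φ|})
      Filter.atTop (nhds 0)) := by
  obtain ⟨B, hB⟩ := hφb
  have hB0 : 0 ≤ B := by
    obtain ⟨x⟩ := MeasureTheory.nonempty_of_isProbabilityMeasure F.M₀
    exact (abs_nonneg _).trans (hB (x, x))
  obtain ⟨g, hg0, hg⟩ := ParticleFilter.exists_G_le F n
  obtain ⟨ρ, hρ0, hρ⟩ := ParticleFilter.exists_particleNumber_le_mul hc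
  obtain ⟨δ, hδ0, hδ⟩ := ParticleFilter.exists_le_mul_particleNumber hc
  obtain ⟨C, hC⟩ := ParticleFilter.exists_mse_le F n hg hg0 hρ0 hδ0 hB0
  have hmse : ∀ N : ℕ, 1 ≤ N → (∀ p ≤ n, 2 ≤ ParticleFilter.particleNumber c N p) →
      (N : ℝ) * ∫ ω, (ParticleFilter.muN F (ParticleFilter.particleNumber c N) n b φ ω -
          ParticleFilter.mu F n b φ) ^ 2
        ∂(ParticleFilter.jointLaw F (ParticleFilter.particleNumber c N) n) ≤ C := by
    intro N hN1 hN
    rw [ParticleFilter.integral_muN_sub_sq F b hN hφ hB]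
    exact hC _ N (Nat.cast_nonneg N) hN (hρ N hN1 hN) (hδ N) b φ hφ hB
  have hprob : ∀ N : ℕ, (∀ p ≤ n, 2 ≤ ParticleFilter.particleNumber c N p) →
      MeasureTheory.IsProbabilityMeasure
        (ParticleFilter.jointLaw F (ParticleFilter.particleNumber c N) n) := fun N hN =>
    ParticleFilter.isProbabilityMeasure_jointLaw F fun p hp => lt_of_lt_of_le two_pos (hN p hp)
  -- Integrability accompanies both moment claims, since the integral of a non-integrable function
  -- is 0 by convention and would make them void.
  refine ⟨fun N _ hN => ⟨?_, ParticleFilter.integral_muN F b hN hφ hB⟩,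
    ⟨C, fun N hN1 hN => ⟨ParticleFilter.memLp_muN F b hN hφ hB 2, hmse N hN1 hN⟩⟩, fun ε hε => ?_⟩
  · exact MeasureTheory.memLp_one_iff_integrable.1 (ParticleFilter.memLp_muN F b hN hφ hB 1)
  · refine ParticleFilter.tendsto_measure_ge_of_mul_integral_sq_le _ _ C ?_ hε
    filter_upwards [ParticleFilter.eventually_two_le_particleNumber hc,
      Filter.eventually_ge_atTop 1] with N hN hN1
    have := hprob N hN
    exact ⟨inferInstance, (ParticleFilter.memLp_muN F b hN hφ hB 2).sub
      (MeasureTheory.memLp_const _), hmse N hN1 hN⟩
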